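/- Let $m\ge 1$, $n\ge 0$ be coprime. An $(m,n)$-Dyck path is a lattice path of unit North and East steps from $(0,0)$ to $(m,n)$ whose vertices all lie weakly above the line from $(0,0)$ to $(m,n)$; $\mathcal D_{m,n}$ is the set of these paths (so $\mathcal D_{1,0}$ consists of the path with one East step). The vertex $(x,y)$ has rank $my-nx$. The rank sequence $r_1(D)<r_2(D)<\cdots<r_{m+n}(D)$ of $D\in\mathcal D_{m,n}$ is the increasing rearrangement of the ranks of the starting vertices of its $m+n$ steps. The sweep map $\Phi$ sends $D$ to the path obtained by arranging the steps of $D$ in increasing order of the ranks of their starting vertices. Let $\operatorname{area}(D)$ be the number of lattice cells that lie below $D$ and above the main diagonal and are not cut by this diagonal. Let $\operatorname{dinv}(D)$ be the number of lattice cells above $D$ for which the rank $a$ of the starting vertex of the East step of $D$ in the same column and the rank $b$ of the starting vertex of the North step of $D$ in the same row satisfy $0<a-b<m+n$. Where $\Phi$ is a bijection of $\mathcal D_{m,n}$ onto itself, put $\operatorname{bounce}(D)=\operatorname{area}(\Phi^{-1}(D))$. Proposition. Let $k\ge 1$, $n\ge 1$, $m=kn+1$, $n'=n-1$ and $m'=kn'+1$.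 Then $\Phi$ is a bijection of $\mathcal D_{m,n}$ onto itself and of $\mathcal D_{m',n'}$ onto itself. Put $$C_n^{(k)}(q,t)=\sum_{D\in\mathcal D_{kn+1,n}}q^{\operatorname{area}(D)}t^{\operatorname{bounce}(D)}\in\mathbb Z[q,t],$$ and let $\chi(P)$ be $1$ if $P$ holds and $0$ otherwise. Then $$C_n^{(k)}(q,t)=\sum_{D'\in\mathcal D_{m',n'}}q^{\operatorname{area}(D')}t^{\operatorname{bounce}(D')}\sum_{i=1}^{m'+n'}\chi(\bar r_i(D')<m')\,q^{i-1}t^{n'k-\bar r_i(D')},$$ where $\bar r_i(D')=r_i(\Phi^{-1}(D'))$ is the $i$-th smallest rank of $\Phi^{-1}(D')$, and also $$C_n^{(k)}(q,t)=\sum_{D'\in\mathcal D_{m',n'}}q^{\operatorname{dinv}(D')}t^{\operatorname{area}(D')}\sum_{i=1}^{m'+n'}\chi(r_i(D')<m')\,q^{i-1}t^{n'k-r_i(D')}.$$ -/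

import Mathlib

namespace FussDyck

/-- Unit lattice steps. A North step is the letter `S` (and an East step the letter `W`) of the
word of a path that records the starting points of its steps. -/
inductive Step where
  | north : Step
  | east : Step
  deriving DecidableEq

/-- A lattice path starting at the origin, as the word of its successive steps. -/
abbrev Path := List Step

/-- The rank of the end point of the path `u` in the `m × n` rectangle: each North step adds `m`
and each East step subtracts `n`. -/
def rank (m n : ℕ) (u : Path) : ℤ :=
  (m : ℤ) * (u.count Step.north : ℤ) - (n : ℤ) * (u.count Step.east : ℤ)

/-- `w` is an `(m, n)`-Dyck path: it goes from `(0, 0)` to `(m, n)`, and every vertex `(x, y)` of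
it lies weakly above the diagonal, that is `x * n ≤ y * m`. -/
def IsDyckPath (m n : ℕ) (w : Path) : Prop :=
  w.count Step.east = m ∧ w.count Step.north = n ∧
    ∀ i ∈ Finset.range (w.length + 1),
      (w.take i).count Step.east * n ≤ (w.take i).count Step.north * m

instance (m n : ℕ) (w : Path) : Decidable (IsDyckPath m n w) := by
  unfold IsDyckPath; infer_instance

/-- The finite set of all `(m, n)`-Dyck paths (see `mem_dyckPaths`). -/
def dyckPaths (m n : ℕ) : Finset Path :=
  ((List.replicate n Step.north ++ List.replicate m Step.east).permutations.toFinset).filter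
    (IsDyckPath m n)

theorem mem_dyckPaths {m n : ℕ} {w : Path} : w ∈ dyckPaths m n ↔ IsDyckPath m n w := by
  unfold dyckPaths
  rw [Finset.mem_filter, List.mem_toFinset, List.mem_permutations]
  refine ⟨fun h => h.2, fun h => ⟨?_, h⟩⟩
  rw [List.perm_iff_count]
  intro a
  cases a
  · rw [h.2.1]; simp [List.count_append, List.count_replicate]
  · rw [h.1]; simp [List.count_append, List.count_replicate]

/-- The ranks of the starting vertices of the successive steps of `w`. For a Dyck path these are
the ranks of all its vertices, the last vertex (of rank `0`, like the first) being left out. -/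
def startRanks (m n : ℕ) (w : Path) : List ℤ :=
  (List.range w.length).map fun i => rank m n (w.take i)

/-- The rank sequence of `w`: its ranks in increasing order. -/
def rankSeq (m n : ℕ) (w : Path) : List ℤ :=
  (startRanks m n w).mergeSort fun a b => decide (a ≤ b)

/-- The `i`-th smallest rank of `w`, for `1 ≤ i ≤ w.length`. -/
def rankAt (m n : ℕ) (w : Path) (i : ℕ) : ℤ :=
  (rankSeq m n w).getD (i - 1) 0

/-- The sweep map: the steps of `w`, rearranged by increasing rank of their starting vertices. -/
def sweep (m n : ℕ) (w : Path) : Path :=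
  (((startRanks m n w).zip w).mergeSort fun a b => decide (a.1 ≤ b.1)).map Prod.snd

/-- The inverse of the sweep map on `(m, n)`-Dyck paths (meaningful where the sweep map is a
bijection of the set of these paths onto itself). -/
noncomputable def sweepInv (m n : ℕ) : Path → Path :=
  Function.invFunOn (sweep m n) (dyckPaths m n : Set Path)

/-- The number of lattice cells between the path and the lattice diagonal (the cells cut by the
main diagonal). A cell below the path is given by the North step `i` in its row and the East step
`j` in its column, where `i` comes before `j`; its lower right corner is `(x + 1, y)`, where `x` is
the number of East steps before `j` and `y` the number of North steps before `i`. The cell lies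
above the main diagonal without being cut by it iff that corner is weakly above the diagonal. -/
def area (m n : ℕ) (w : Path) : ℕ :=
  ((Finset.range w.length ×ˢ Finset.range w.length).filter fun p =>
    p.1 < p.2 ∧ w[p.1]? = some Step.north ∧ w[p.2]? = some Step.east ∧
      ((w.take p.2).count Step.east + 1) * n ≤ (w.take p.1).count Step.north * m).card

/-- A cell above the path is given by the East step `i` in its column and the North step `j` in its
row, where `i` comes before `j`. It contributes to `dinv` iff the rank `a` of the left vertex at the
bottom of its column (the start of step `i`) and the rank `b` of the bottom vertex at the end of its
row (the start of step `j`) satisfy `0 < a - b < m + n`. -/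
def dinv (m n : ℕ) (w : Path) : ℕ :=
  ((Finset.range w.length ×ˢ Finset.range w.length).filter fun p =>
    p.1 < p.2 ∧ w[p.1]? = some Step.east ∧ w[p.2]? = some Step.north ∧
      0 < rank m n (w.take p.1) - rank m n (w.take p.2) ∧
      rank m n (w.take p.1) - rank m n (w.take p.2) < (m : ℤ) + (n : ℤ)).card

/-- The area of the preimage under the sweep map. -/
noncomputable def bounce (m n : ℕ) (w : Path) : ℕ :=
  area m n (sweepInv m n w)

/-- The variable `q` of `ℤ[q, t]`. -/
noncomputable def q : MvPolynomial (Fin 2) ℤ := MvPolynomial.X 0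

/-- The variable `t` of `ℤ[q, t]`. -/
noncomputable def t : MvPolynomial (Fin 2) ℤ := MvPolynomial.X 1

/-- The higher `q, t`-Catalan polynomial `C_n^{(k)}(q, t)`. -/
noncomputable def higherCatalan (k n : ℕ) : MvPolynomial (Fin 2) ℤ :=
  ∑ D ∈ dyckPaths (k * n + 1) n,
    q ^ area (k * n + 1) n D * t ^ bounce (k * n + 1) n D

end FussDyck

/-! Give the vertex $(x,y)$ the level $ky-x$. Its rank is $n\cdot\text{level}+y$, so on a Dyck path
in the $(kn+1)\times n$ rectangle ranks compare by level, with ties broken from left to right. The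
Dyck paths are then the words whose steps all start at levels $\ge 0$ and which end at level $-1$.
The sweep map reads the path level by level; area is the sum of the levels where North steps start;
dinv counts pairs "East before North" whose level drop lies in $[1,k+1]$ (`isDyckPath_iff`,
`IsFuss.sweep_eq`, `IsFuss.area_eq`, `IsFuss.dinv_eq`).

Bijectivity of $\Phi$ and $\operatorname{area}\circ\Phi=\operatorname{dinv}$ come from one induction
on $n$. The last North step of maximal level $a$ is followed by at least $k+1$ East steps, so
deleting it with $k$ of them leaves a smaller Dyck path $AB$. On the swept side this turns
$X\,N\,E^{s+1+k}$ into $X\,E^{s+1}$. Both area of the sweep and dinv drop by $s$, and $|X|$ tells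
where the deleted piece was (`IsPeak.exists_sweep_eq`, `IsPeak.pairCount_insertPeak`,
`IsPeak.eq_of_countP_eq`). Hence $C_n^{(k)}=\sum q^{\operatorname{dinv}}t^{\operatorname{area}}$.

The recursion uses another decomposition. A path of order $n+1$ has the form $N\,W\,E^k$, and by the
cycle lemma $W=BA$ for exactly one Dyck path $AB$ of order $n$ with $B$ nonempty. The pair is thus a
path $D'=AB$ with a marked vertex, and the marked vertices that occur are those of level below $k$,
that is of rank below $m'$. If the marked vertex has the $i$-th smallest rank $r_i$, then area grows
by $n'k-r_i$ (`IsFuss.area_glue`) and dinv by $i-1$ (`IsFuss.dinv_glue`). The latter is read off the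
sweeps: that of the new path is a North step followed by the sweep of $D'$ with one East step
inserted after each of $k$ successive blocks. Substituting $D'\mapsto\Phi^{-1}(D')$ gives the
formula with bounce. -/

namespace FussDyck

/-! ### Pairs in a list -/

/-- The number of pairs of entries of a list, in the order of the list, that are in relation `R`. -/
def pairCount {α : Type*} (R : α → α → Bool) : List α → ℕ
  | [] => 0
  | a :: l => l.countP (R a) + pairCount R l

/-- The number of pairs of an entry of `l₁` and an entry of `l₂` that are in relation `R`. -/
def crossCount {α : Type*} (R : α → α → Bool) (l₁ l₂ : List α) : ℕ :=
  (l₁.map fun a => l₂.countP (R a)).sum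

theorem pairCount_append {α : Type*} (R : α → α → Bool) (l₁ l₂ : List α) :
    pairCount R (l₁ ++ l₂) = pairCount R l₁ + pairCount R l₂ + crossCount R l₁ l₂ := by
  induction l₁ with
  | nil => simp [pairCount, crossCount]
  | cons a l ih =>
    simp only [List.cons_append, pairCount, ih, crossCount, List.map_cons, List.sum_cons,
      List.countP_append]
    ring

theorem crossCount_append_right {α : Type*} (R : α → α → Bool) (l₁ l₂ l₃ : List α) :
    crossCount R l₁ (l₂ ++ l₃) = crossCount R l₁ l₂ + crossCount R l₁ l₃ := by
  simp [crossCount, List.countP_append, List.sum_map_add]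

theorem pairCount_congr {α : Type*} {R R' : α → α → Bool} {l : List α}
    (h : l.Pairwise fun a b => R a b = R' a b) : pairCount R l = pairCount R' l := by
  induction l with
  | nil => rfl
  | cons a l ih =>
    rw [List.pairwise_cons] at h
    simp only [pairCount, ih h.2]
    congr 1
    exact List.countP_congr fun b hb => by rw [h.1 b hb]

theorem pairCount_map {α β : Type*} (R : β → β → Bool) (f : α → β) (l : List α) :
    pairCount R (l.map f) = pairCount (fun a b => R (f a) (f b)) l := by
  induction l with
  | nil => rfl
  | cons a l ih => simp [pairCount, ih, List.countP_map, Function.comp_def]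

theorem sum_range_ite_eq_countP {α : Type*} (p : α → Bool) (l : List α) (Q : ℕ → Prop)
    [DecidablePred Q] (h : ∀ i (hi : i < l.length), Q i ↔ p l[i] = true) :
    ∑ i ∈ Finset.range l.length, (if Q i then 1 else 0) = l.countP p := by
  induction l generalizing Q with
  | nil => simp
  | cons a l ih =>
    rw [List.length_cons, Finset.sum_range_succ', ih (fun i => Q (i + 1)), List.countP_cons]
    · congr 1
      have := h 0 (by simp)
      simp only [List.getElem_cons_zero] at this
      simp [this]
    · intro i hi
      exact h (i + 1) (by simpa using hi)

theorem card_filter_eq_pairCount {α : Type*} (R : α → α → Bool) (l : List α) (Q : ℕ → ℕ → Prop)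
    [∀ i j, Decidable (Q i j)]
    (h : ∀ i j (hi : i < l.length) (hj : j < l.length), Q i j ↔ R l[i] l[j] = true) :
    ((Finset.range l.length ×ˢ Finset.range l.length).filter fun p =>
      p.1 < p.2 ∧ Q p.1 p.2).card = pairCount R l := by
  rw [Finset.card_filter, Finset.sum_product]
  induction l generalizing Q with
  | nil => simp [pairCount]
  | cons a l ih =>
    rw [List.length_cons, Finset.sum_range_succ']
    simp only [Finset.sum_range_succ' _ l.length]
    simp only [Nat.add_lt_add_iff_right, Nat.not_lt_zero, false_and, if_false, add_zero,
      Nat.zero_lt_succ, true_and]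
    rw [ih (fun i j => Q (i + 1) (j + 1)), pairCount,
      sum_range_ite_eq_countP (R a) l (fun j => Q 0 (j + 1)), add_comm]
    · intro i hi
      exact h 0 (i + 1) (by simp) (by simpa using hi)
    · intro i j hi hj
      exact h (i + 1) (j + 1) (by simpa using hi) (by simpa using hj)

/-! ### Vertices and levels -/

/-- The starting vertices of the steps of a path that starts at `(x, y)`, with these steps. -/
def vertices : ℕ → ℕ → Path → List (ℕ × ℕ × Step)
  | _, _, [] => []
  | x, y, Step.north :: w => (x, y, Step.north) :: vertices x (y + 1) w
  | x, y, Step.east :: w => (x, y, Step.east) :: vertices (x + 1) y w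

@[simp] theorem length_vertices (x y : ℕ) (w : Path) : (vertices x y w).length = w.length := by
  induction w generalizing x y with
  | nil => rfl
  | cons s w ih => cases s <;> simp [vertices, ih]

theorem getElem_vertices (x y : ℕ) (w : Path) (i : ℕ) (hi : i < w.length) :
    (vertices x y w)[i]'(by simpa using hi) =
      (x + (w.take i).count Step.east, y + (w.take i).count Step.north, w[i]) := by
  induction w generalizing x y i with
  | nil => simp at hi
  | cons s w ih =>
    cases i with
    | zero => cases s <;> simp [vertices]
    | succ i =>
      have hi' : i < w.length := by simpa using hi
      cases s <;> simp [vertices, ih _ _ i hi'] <;> omega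

theorem vertices_append (x y : ℕ) (u w : Path) :
    vertices x y (u ++ w) =
      vertices x y u ++ vertices (x + u.count Step.east) (y + u.count Step.north) w := by
  induction u generalizing x y with
  | nil => simp [vertices]
  | cons s u ih =>
    cases s <;>
      simp [vertices, ih, Nat.add_comm, Nat.add_left_comm]

/-- The level `k * y - x` of a vertex. -/
def level (k : ℕ) (v : ℕ × ℕ × Step) : ℤ := (k : ℤ) * v.2.1 - v.1

/-- The rank `m * y - n * x` of a vertex. -/
def vertexRank (m n : ℕ) (v : ℕ × ℕ × Step) : ℤ := (m : ℤ) * v.2.1 - (n : ℤ) * v.1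

/-- The change of the level along a step. -/
def rise (k : ℕ) : Step → ℤ
  | Step.north => k
  | Step.east => -1

/-- The change of the level along a path. -/
def height (k : ℕ) : Path → ℤ
  | [] => 0
  | s :: w => rise k s + height k w

@[simp] theorem height_nil (k : ℕ) : height k [] = 0 := rfl

@[simp] theorem height_cons (k : ℕ) (s : Step) (w : Path) :
    height k (s :: w) = rise k s + height k w := rfl

@[simp] theorem rise_north (k : ℕ) : rise k Step.north = k := rfl
@[simp] theorem rise_east (k : ℕ) : rise k Step.east = -1 := rfl

@[simp] theorem height_append (k : ℕ) (u w : Path) :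
    height k (u ++ w) = height k u + height k w := by
  induction u with
  | nil => simp
  | cons s u ih => simp [ih, add_assoc]

theorem height_eq (k : ℕ) (w : Path) :
    height k w = (k : ℤ) * w.count Step.north - w.count Step.east := by
  induction w with
  | nil => simp
  | cons s w ih => cases s <;> simp [ih] <;> ring

@[simp] theorem height_replicate_east (k i : ℕ) :
    height k (List.replicate i Step.east) = -i := by
  rw [height_eq]; simp [List.count_replicate]

/-- The steps of a path that starts at level `a`, with the levels of their starting vertices. -/
def levels (k : ℕ) : ℤ → Path → List (ℤ × Step)
  | _, [] => []
  | a, s :: w => (a, s) :: levels k (a + rise k s) w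

@[simp] theorem levels_nil (k : ℕ) (a : ℤ) : levels k a [] = [] := rfl

@[simp] theorem levels_cons (k : ℕ) (a : ℤ) (s : Step) (w : Path) :
    levels k a (s :: w) = (a, s) :: levels k (a + rise k s) w := rfl

theorem levels_append (k : ℕ) (a : ℤ) (u w : Path) :
    levels k a (u ++ w) = levels k a u ++ levels k (a + height k u) w := by
  induction u generalizing a with
  | nil => simp
  | cons s u ih => simp [ih, add_assoc]

@[simp] theorem length_levels (k : ℕ) (a : ℤ) (w : Path) : (levels k a w).length = w.length := by
  induction w generalizing a with
  | nil => rfl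
  | cons s w ih => simp [ih]

theorem levels_add (k : ℕ) (a c : ℤ) (w : Path) :
    levels k (a + c) w = (levels k a w).map fun v => (v.1 + c, v.2) := by
  induction w generalizing a with
  | nil => rfl
  | cons s w ih => simp [← ih, add_right_comm]

theorem map_level_vertices (k x y : ℕ) (w : Path) :
    (vertices x y w).map (fun v => (level k v, v.2.2)) = levels k ((k : ℤ) * y - x) w := by
  induction w generalizing x y with
  | nil => rfl
  | cons s w ih =>
    cases s
    · rw [vertices, List.map_cons, ih, levels_cons]
      simp only [level, rise_north]; push_cast; ring_nf
    · rw [vertices, List.map_cons, ih, levels_cons]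
      simp only [level, rise_east]; push_cast; ring_nf

/-- The number of North steps. -/
theorem countP_levels_north (k : ℕ) (a : ℤ) (w : Path) :
    (levels k a w).countP (fun v => v.2 = Step.north) = w.count Step.north := by
  induction w generalizing a with
  | nil => rfl
  | cons s w ih => cases s <;> simp [ih]

/-- All steps of the path that starts at level `a` start at nonnegative levels. -/
def Nonneg (k : ℕ) (a : ℤ) (w : Path) : Prop := ∀ v ∈ levels k a w, 0 ≤ v.1

@[simp] theorem nonneg_nil (k : ℕ) (a : ℤ) : Nonneg k a [] := by simp [Nonneg]

@[simp] theorem nonneg_cons (k : ℕ) (a : ℤ) (s : Step) (w : Path) :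
    Nonneg k a (s :: w) ↔ 0 ≤ a ∧ Nonneg k (a + rise k s) w := by
  simp [Nonneg]

@[simp] theorem nonneg_append (k : ℕ) (a : ℤ) (u w : Path) :
    Nonneg k a (u ++ w) ↔ Nonneg k a u ∧ Nonneg k (a + height k u) w := by
  simp only [Nonneg, levels_append, List.mem_append]
  exact ⟨fun h => ⟨fun v hv => h v (Or.inl hv), fun v hv => h v (Or.inr hv)⟩,
    fun h v hv => hv.elim (h.1 v) (h.2 v)⟩

theorem Nonneg.mono {k : ℕ} {a b : ℤ} {w : Path} (h : Nonneg k a w) (hab : a ≤ b) :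
    Nonneg k b w := by
  induction w generalizing a b with
  | nil => simp
  | cons s w ih =>
    rw [nonneg_cons] at h ⊢
    exact ⟨h.1.trans hab, ih h.2 (by linarith)⟩

theorem nonneg_replicate_east (k i : ℕ) {a : ℤ} (h : (i : ℤ) ≤ a + 1) :
    Nonneg k a (List.replicate i Step.east) := by
  induction i generalizing a with
  | zero => simp
  | succ i ih =>
    rw [List.replicate_succ, nonneg_cons]
    push_cast at h
    exact ⟨by omega, ih (by simp only [rise_east]; omega)⟩

/-- `(k * n + 1, n)`-Dyck paths in terms of levels. -/
def IsFuss (k n : ℕ) (w : Path) : Prop :=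
  w.count Step.north = n ∧ height k w = -1 ∧ Nonneg k 0 w

theorem nonneg_iff (k : ℕ) (w : Path) :
    Nonneg k 0 w ↔ ∀ i < w.length, 0 ≤ height k (w.take i) := by
  suffices ∀ a : ℤ, Nonneg k a w ↔ ∀ i < w.length, 0 ≤ a + height k (w.take i) by simpa using this 0
  intro a
  induction w generalizing a with
  | nil => simp
  | cons s w ih =>
    rw [nonneg_cons, ih]
    constructor
    · rintro ⟨h0, h⟩ i hi
      cases i with
      | zero => simpa using h0
      | succ i => simpa [add_assoc] using h i (by simpa using hi)
    · intro h
      exact ⟨by simpa using h 0 (by simp), fun i hi => by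
        simpa [add_assoc] using h (i + 1) (by simpa using hi)⟩

theorem length_eq_count (w : Path) : w.length = w.count Step.east + w.count Step.north := by
  induction w with
  | nil => rfl
  | cons s w ih => cases s <;> simp [ih] <;> omega

/-- Being above the diagonal means $n\cdot\text{level}+y\ge 0$. As $y\le n$, a negative level is
possible only for level $-1$ and $y=n$, which is the final vertex and starts no step. -/
theorem isDyckPath_iff (k n : ℕ) (w : Path) : IsDyckPath (k * n + 1) n w ↔ IsFuss k n w := by
  unfold IsDyckPath IsFuss
  have key : ∀ i, (w.take i).count Step.east * n ≤ (w.take i).count Step.north * (k * n + 1) ↔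
      0 ≤ (n : ℤ) * height k (w.take i) + (w.take i).count Step.north := by
    intro i
    rw [height_eq]
    zify
    constructor <;> intro h <;> nlinarith
  constructor
  · rintro ⟨hE, hN, h⟩
    refine ⟨hN, by rw [height_eq, hE, hN]; push_cast; ring, (nonneg_iff k w).2 fun i hi => ?_⟩
    have h1 := (key i).1 (h i (by simp; omega))
    by_contra! hneg
    have hle : (w.take i).count Step.north ≤ n := hN ▸ (List.take_sublist i w).count_le _
    have hlE : (w.take i).count Step.east ≤ k * n + 1 := hE ▸ (List.take_sublist i w).count_le _
    have hlen := length_eq_count (w.take i)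
    have hlen' := length_eq_count w
    rw [List.length_take, min_eq_left hi.le] at hlen
    have hyn : (w.take i).count Step.north = n := by
      zify at hle ⊢
      nlinarith
    rw [height_eq, hyn] at hneg
    have : (k * n + 1 : ℕ) ≤ (w.take i).count Step.east := by
      zify; linarith
    omega
  · rintro ⟨hN, hh, h⟩
    have hE : w.count Step.east = k * n + 1 := by
      rw [height_eq, hN] at hh
      zify; linarith
    refine ⟨hE, hN, fun i hi => (key i).2 ?_⟩
    rw [Finset.mem_range] at hi
    rcases (Nat.lt_succ_iff.1 hi).lt_or_eq with hlt | rfl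
    · have := (nonneg_iff k w).1 h i hlt
      positivity
    · rw [List.take_length, hh, hN]; simp

theorem mem_dyckPaths_iff {k n : ℕ} {w : Path} :
    w ∈ dyckPaths (k * n + 1) n ↔ IsFuss k n w := mem_dyckPaths.trans (isDyckPath_iff k n w)

theorem IsFuss.count_east {k n : ℕ} {w : Path} (h : IsFuss k n w) :
    w.count Step.east = k * n + 1 := ((isDyckPath_iff k n w).2 h).1

theorem IsFuss.length_eq {k n : ℕ} {w : Path} (h : IsFuss k n w) :
    w.length = k * n + 1 + n := by rw [length_eq_count, h.count_east, h.1]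

theorem vertices_bounds {x y : ℕ} {w : Path} {v : ℕ × ℕ × Step} (hv : v ∈ vertices x y w) :
    x ≤ v.1 ∧ y ≤ v.2.1 ∧ v.2.1 ≤ y + w.count Step.north ∧
      (v.2.2 = Step.north → v.2.1 < y + w.count Step.north) := by
  induction w generalizing x y with
  | nil => simp [vertices] at hv
  | cons s w ih =>
    cases s <;> simp only [vertices, List.mem_cons] at hv <;> rcases hv with rfl | hv
    · simp
    · obtain ⟨h1, h2, h3, h4⟩ := ih hv
      rw [List.count_cons_self]
      exact ⟨by omega, by omega, by omega, fun e => by have := h4 e; omega⟩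
    · simp
    · obtain ⟨h1, h2, h3, h4⟩ := ih hv
      rw [List.count_cons_of_ne (by simp)]
      exact ⟨by omega, by omega, by omega, h4⟩

theorem pairwise_vertices (x y : ℕ) (w : Path) : (vertices x y w).Pairwise fun u v =>
    u.1 ≤ v.1 ∧ u.2.1 ≤ v.2.1 ∧ u.1 + u.2.1 < v.1 + v.2.1 := by
  induction w generalizing x y with
  | nil => simp [vertices]
  | cons s w ih =>
    cases s <;> simp only [vertices, List.pairwise_cons] <;> refine ⟨fun v hv => ?_, ih _ _⟩ <;>
      have := vertices_bounds hv <;> omega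

theorem IsFuss.level_nonneg {k n : ℕ} {w : Path} (h : IsFuss k n w) {v : ℕ × ℕ × Step}
    (hv : v ∈ vertices 0 0 w) : 0 ≤ level k v := by
  have := h.2.2 (level k v, v.2.2)
  apply this
  have h2 := map_level_vertices k 0 0 w
  simp only [Nat.cast_zero, mul_zero, sub_zero] at h2
  rw [← h2]
  exact List.mem_map_of_mem hv

theorem levels_zero (k : ℕ) (w : Path) :
    levels k 0 w = (vertices 0 0 w).map (fun v => (level k v, v.2.2)) := by
  rw [map_level_vertices]; simp

/-! ### Area and dinv in terms of levels -/

/-- The sum of the levels of the starting points of the North steps of a path that starts at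
level `a`. -/
def northSum (k : ℕ) : ℤ → Path → ℤ
  | _, [] => 0
  | a, Step.north :: w => a + northSum k (a + k) w
  | a, Step.east :: w => northSum k (a - 1) w

theorem northSum_append (k : ℕ) (a : ℤ) (u w : Path) :
    northSum k a (u ++ w) = northSum k a u + northSum k (a + height k u) w := by
  induction u generalizing a with
  | nil => simp [northSum]
  | cons s u ih => cases s <;> simp [northSum, ih] <;> ring_nf

theorem northSum_add (k : ℕ) (a c : ℤ) (w : Path) :
    northSum k (a + c) w = northSum k a w + c * w.count Step.north := by
  induction w generalizing a with
  | nil => simp [northSum]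
  | cons s w ih =>
    cases s
    · simp only [northSum, List.count_cons_self]
      rw [add_right_comm a c (k : ℤ), ih]; push_cast; ring
    · simp only [northSum]
      rw [add_sub_right_comm, ih]; simp

@[simp] theorem northSum_replicate_east (k i : ℕ) (a : ℤ) :
    northSum k a (List.replicate i Step.east) = 0 := by
  induction i generalizing a with
  | zero => rfl
  | succ i ih => rw [List.replicate_succ, northSum, ih]

theorem countP_vertices_east_lt (x y T : ℕ) (w : Path) :
    (vertices x y w).countP (fun v => v.2.2 = Step.east ∧ v.1 < T) =
      min (w.count Step.east) (T - x) := by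
  induction w generalizing x y with
  | nil => simp [vertices]
  | cons s w ih =>
    cases s
    · rw [vertices, List.countP_cons, ih, List.count_cons_of_ne (by simp)]
      simp
    · simp only [vertices, List.countP_cons, ih, List.count_cons_self]
      by_cases hx : x < T <;> simp [hx] <;> omega

/-- For a North step starting at height $y<n$, the cells counted in its row are those whose East
step has abscissa $X<ky$. Since $x\le ky\le kn$, all abscissas from $x$ to $ky-1$ are still to come,
so there are $ky-x$ of them: the level of the step. -/
theorem pairCount_area {k n x y : ℕ} {w : Path} (hx : x + w.count Step.east = k * n + 1)
    (hy : y + w.count Step.north = n) (h : Nonneg k ((k : ℤ) * y - x) w) :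
    (pairCount (fun u v : ℕ × ℕ × Step => decide (u.2.2 = Step.north ∧ v.2.2 = Step.east ∧
      (v.1 + 1) * n ≤ u.2.1 * (k * n + 1))) (vertices x y w) : ℤ) =
      northSum k ((k : ℤ) * y - x) w := by
  induction w generalizing x y with
  | nil => rfl
  | cons s w ih =>
    rw [nonneg_cons] at h
    cases s
    · simp only [List.count_cons_self, ne_eq, reduceCtorEq, not_false_eq_true,
        List.count_cons_of_ne, rise_north] at hx hy h
      have hyn : y < n := by omega
      have hcond : ∀ X : ℕ, (X + 1) * n ≤ y * (k * n + 1) ↔ X < k * y := by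
        intro X
        constructor <;> intro hX
        · by_contra! hc
          nlinarith
        · nlinarith
      have hkn : k * y ≤ k * n := Nat.mul_le_mul_left _ hyn.le
      have hxy : x ≤ k * y := by zify; linarith [h.1]
      simp only [vertices, pairCount, true_and, hcond, countP_vertices_east_lt, northSum]
      rw [min_eq_right (by omega)]
      push_cast [hxy]
      rw [ih (by omega) (by omega) (by push_cast; convert h.2 using 1; ring)]
      push_cast; ring_nf
    · simp only [List.count_cons_self, ne_eq, reduceCtorEq, not_false_eq_true,
        List.count_cons_of_ne, rise_east] at hx hy h
      simp only [vertices, pairCount, northSum, reduceCtorEq, false_and, decide_false,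
        List.countP_false, Function.const_apply, zero_add]
      rw [ih (x := x + 1) (y := y) (by omega) (by omega) (by push_cast; convert h.2 using 1; ring)]
      push_cast; ring_nf

theorem IsFuss.area_eq {k n : ℕ} {w : Path} (h : IsFuss k n w) :
    (area (k * n + 1) n w : ℤ) = northSum k 0 w := by
  have h1 := pairCount_area (k := k) (n := n) (x := 0) (y := 0) (w := w)
    (by rw [h.count_east]; simp) (by rw [h.1]; simp) (by simpa using h.2.2)
  simp only [Nat.cast_zero, mul_zero, sub_zero] at h1
  rw [← h1, ← card_filter_eq_pairCount _ _ (fun i j => w[i]? = some Step.north ∧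
    w[j]? = some Step.east ∧ ((w.take j).count Step.east + 1) * n ≤
      (w.take i).count Step.north * (k * n + 1)), length_vertices]
  · rfl
  · intro i j hi hj
    rw [length_vertices] at hi hj
    simp [getElem_vertices, hi, hj]

/-- The pairs of steps that contribute to `dinv`, in terms of their levels. -/
def dinvRel (k : ℕ) (u v : ℤ × Step) : Bool :=
  u.2 = Step.east ∧ v.2 = Step.north ∧ 1 ≤ u.1 - v.1 ∧ u.1 - v.1 ≤ (k : ℤ) + 1

theorem vertexRank_eq (k n : ℕ) (v : ℕ × ℕ × Step) :
    vertexRank (k * n + 1) n v = n * level k v + v.2.1 := by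
  simp only [vertexRank, level]; push_cast; ring

/-- The rank difference is $n\Delta+(y_u-y_v)$ with $\Delta$ the level difference and $-n<y_u-y_v\le
0$; it lies strictly between $0$ and $n(k+1)+1$ exactly when $1\le\Delta\le k+1$. -/
theorem IsFuss.dinv_eq {k n : ℕ} {w : Path} (h : IsFuss k n w) :
    dinv (k * n + 1) n w = pairCount (dinvRel k) (levels k 0 w) := by
  rw [levels_zero, pairCount_map]
  have : dinv (k * n + 1) n w = pairCount (fun u v : ℕ × ℕ × Step =>
      decide (u.2.2 = Step.east ∧ v.2.2 = Step.north ∧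
        0 < vertexRank (k * n + 1) n u - vertexRank (k * n + 1) n v ∧
        vertexRank (k * n + 1) n u - vertexRank (k * n + 1) n v < ((k * n + 1 : ℕ) : ℤ) + n))
        (vertices 0 0 w) := by
    rw [← card_filter_eq_pairCount _ _ (fun i j => w[i]? = some Step.east ∧
      w[j]? = some Step.north ∧
      0 < rank (k * n + 1) n (w.take i) - rank (k * n + 1) n (w.take j) ∧
      rank (k * n + 1) n (w.take i) - rank (k * n + 1) n (w.take j) <
        ((k * n + 1 : ℕ) : ℤ) + (n : ℤ)), length_vertices]
    · rfl
    · intro i j hi hj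
      rw [length_vertices] at hi hj
      simp [getElem_vertices, hi, hj, rank, vertexRank]
  rw [this]
  apply pairCount_congr
  refine (pairwise_vertices 0 0 w).imp_of_mem ?_
  rintro u v hu hv ⟨-, hy, -⟩
  have hb := vertices_bounds hv
  rw [h.1] at hb
  simp only [dinvRel, decide_eq_decide, vertexRank_eq]
  refine and_congr_right fun _ => and_congr_right fun hN => ?_
  have hvn : (v.2.1 : ℤ) < n := by have := hb.2.2.2 hN; omega
  have hy' : (u.2.1 : ℤ) ≤ v.2.1 := by exact_mod_cast hy
  have hu0 : (0 : ℤ) ≤ u.2.1 := by positivity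
  push_cast
  constructor
  · rintro ⟨h1, h2⟩
    constructor
    · by_contra! hc
      nlinarith
    · by_contra! hc
      nlinarith
  · rintro ⟨h1, h2⟩
    constructor <;> nlinarith

/-! ### Ranks and the sweep map in terms of levels -/

/-- On equal levels the later vertex has larger $y$. On different levels $n\cdot\text{level}+y$
could fail to separate only for $y=0$ above $y=n$, but a vertex of positive level has $y\ge 1$. -/
theorem IsFuss.rank_lt_iff {k n : ℕ} {w : Path} (h : IsFuss k n w) :
    (vertices 0 0 w).Pairwise fun u v =>
      (vertexRank (k * n + 1) n u < vertexRank (k * n + 1) n v ↔ level k u ≤ level k v) ∧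
      (vertexRank (k * n + 1) n v < vertexRank (k * n + 1) n u ↔ level k v < level k u) := by
  refine (pairwise_vertices 0 0 w).imp_of_mem ?_
  rintro u v hu hv ⟨hx, hy, hxy⟩
  have hbu := vertices_bounds hu
  have hbv := vertices_bounds hv
  rw [h.1] at hbu hbv
  have hu0 := h.level_nonneg hu
  have hv0 := h.level_nonneg hv
  rw [vertexRank_eq, vertexRank_eq]
  have hyu : (u.2.1 : ℤ) ≤ n := by have := hbu.2.2.1; omega
  have hyv : (v.2.1 : ℤ) ≤ n := by have := hbv.2.2.1; omega
  have hy' : (u.2.1 : ℤ) ≤ v.2.1 := by exact_mod_cast hy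
  have hpos : ∀ z : ℕ × ℕ × Step, 1 ≤ level k z → (1 : ℤ) ≤ z.2.1 := by
    intro z hz
    by_contra! hc
    have : (z.2.1 : ℤ) = 0 := by omega
    simp only [level, this] at hz
    omega
  rcases lt_trichotomy (level k u) (level k v) with hl | hl | hl
  · have h1 := hpos v (by omega)
    have : (n : ℤ) * level k u + u.2.1 < n * level k v + v.2.1 := by nlinarith
    exact ⟨iff_of_true this hl.le, iff_of_false this.not_gt hl.not_gt⟩
  · have : (u.2.1 : ℤ) < v.2.1 := by
      by_contra! hc
      have he : u.2.1 = v.2.1 := by omega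
      simp only [level, he] at hl
      omega
    rw [hl]
    exact ⟨iff_of_true (by linarith) le_rfl, iff_of_false (by linarith) (lt_irrefl _)⟩
  · have h1 := hpos u (by omega)
    have : (n : ℤ) * level k v + v.2.1 < n * level k u + u.2.1 := by nlinarith
    exact ⟨iff_of_false this.not_gt hl.not_ge, iff_of_true this hl⟩

/-- The steps that start at level `j`, from left to right, of a path that starts at level `a`. -/
def row (k : ℕ) (j a : ℤ) (w : Path) : Path :=
  ((levels k a w).filter fun v => v.1 = j).map Prod.snd

/-- The steps of a path that starts at level `a`, read level by level, at the levels `0, …, M - 1`,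
and from left to right at each level. -/
def sweepRows (k M : ℕ) (a : ℤ) (w : Path) : Path :=
  (List.range M).flatMap fun j : ℕ => row k j a w

theorem IsFuss.level_le {k n : ℕ} {w : Path} (h : IsFuss k n w) {v : ℤ × Step}
    (hv : v ∈ levels k 0 w) : v.1 ≤ k * n := by
  rw [levels_zero, List.mem_map] at hv
  obtain ⟨u, hu, rfl⟩ := hv
  have := (vertices_bounds hu).2.2.1
  rw [h.1, zero_add] at this
  simp only [level]
  have : (k : ℤ) * u.2.1 ≤ k * n := by exact_mod_cast Nat.mul_le_mul_left k this
  omega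

theorem perm_flatMap_filter {α : Type*} (f : α → ℤ) (M : ℕ) (l : List α)
    (h : ∀ a ∈ l, 0 ≤ f a ∧ f a < M) :
    ((List.range M).flatMap fun j : ℕ => l.filter fun a => f a = (j : ℤ)).Perm l := by
  classical
  rw [List.perm_iff_count]
  intro b
  rw [List.count_flatMap]
  by_cases hb : b ∈ l
  · obtain ⟨h0, h1⟩ := h b hb
    have : ∀ j : ℕ, ((l.filter fun a => f a = (j : ℤ)).count b) =
        if j = (f b).toNat then l.count b else 0 := by
      intro j
      split_ifs with hj
      · rw [List.count_filter]
        simp; omega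
      · rw [List.count_eq_zero, List.mem_filter]
        simp; omega
    have hfun : (List.count b ∘ fun j : ℕ => l.filter fun a => f a = (j : ℤ)) =
        fun j => if j = (f b).toNat then l.count b else 0 := funext this
    rw [hfun]
    have hs : ((List.range M).map fun j => if j = (f b).toNat then l.count b else 0).sum =
        ∑ j ∈ Finset.range M, if j = (f b).toNat then l.count b else 0 := rfl
    rw [hs, Finset.sum_ite_eq', if_pos (by rw [Finset.mem_range]; omega)]
  · rw [List.count_eq_zero_of_not_mem hb, List.sum_eq_zero]
    intro x hx
    obtain ⟨j, -, rfl⟩ := List.mem_map.1 hx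
    exact List.count_eq_zero_of_not_mem fun hm => hb (List.mem_filter.1 hm).1

theorem IsFuss.pairwise_rank {k n M : ℕ} {w : Path} (h : IsFuss k n w) :
    ((List.range M).flatMap fun j : ℕ =>
      (vertices 0 0 w).filter fun v => level k v = (j : ℤ)).Pairwise fun u v =>
        vertexRank (k * n + 1) n u < vertexRank (k * n + 1) n v := by
  rw [List.pairwise_flatMap]
  refine ⟨fun j _ => ?_, ?_⟩
  · refine (h.rank_lt_iff.sublist List.filter_sublist).imp_of_mem ?_
    intro u v hu hv huv
    rw [List.mem_filter] at hu hv
    simp only [decide_eq_true_eq] at hu hv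
    rw [huv.1, hu.2, hv.2]
  · refine List.pairwise_lt_range.imp ?_
    intro i j hij u hu v hv
    rw [List.mem_filter] at hu hv
    simp only [decide_eq_true_eq] at hu hv
    have hlt : level k u < level k v := by rw [hu.2, hv.2]; exact_mod_cast hij
    have key : ∀ a ∈ vertices 0 0 w, ∀ b ∈ vertices 0 0 w, (level k a < level k b →
        vertexRank (k * n + 1) n a < vertexRank (k * n + 1) n b) ∧ (level k b < level k a →
        vertexRank (k * n + 1) n b < vertexRank (k * n + 1) n a) := by
      have hsymm : Std.Symm fun a b : ℕ × ℕ × Step => (level k a < level k b →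
        vertexRank (k * n + 1) n a < vertexRank (k * n + 1) n b) ∧ (level k b < level k a →
        vertexRank (k * n + 1) n b < vertexRank (k * n + 1) n a) :=
          ⟨fun _ _ hab => ⟨hab.2, hab.1⟩⟩
      refine List.Pairwise.forall_of_forall ?_ ?_
      · exact fun a _ => ⟨fun h => absurd h (lt_irrefl _), fun h => absurd h (lt_irrefl _)⟩
      · exact h.rank_lt_iff.imp fun hab => ⟨fun hl => hab.1.2 hl.le, hab.2.2⟩
    exact (key u hu.1 v hv.1).1 hlt

theorem startRanks_eq (m n : ℕ) (w : Path) :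
    startRanks m n w = (vertices 0 0 w).map (vertexRank m n) := by
  refine List.ext_getElem (by simp [startRanks]) ?_
  intro i h1 h2
  have hi : i < w.length := by simpa using h2
  simp [startRanks, getElem_vertices, hi, rank, vertexRank]

theorem zip_startRanks (m n : ℕ) (w : Path) :
    (startRanks m n w).zip w = (vertices 0 0 w).map fun v => (vertexRank m n v, v.2.2) := by
  refine List.ext_getElem (by simp [startRanks]) ?_
  intro i h1 h2
  have hi : i < w.length := by simpa using h2
  simp [startRanks, getElem_vertices, hi, rank, vertexRank]

theorem IsFuss.perm_vertices {k n M : ℕ} {w : Path} (h : IsFuss k n w) (hM : k * n < M) :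
    ((List.range M).flatMap fun j : ℕ =>
      (vertices 0 0 w).filter fun v => level k v = (j : ℤ)).Perm (vertices 0 0 w) := by
  refine perm_flatMap_filter (level k) M _ fun v hv => ⟨h.level_nonneg hv, ?_⟩
  have hv' : (level k v, v.2.2) ∈ levels k 0 w := by
    rw [levels_zero]; exact List.mem_map_of_mem hv
  have := h.level_le hv'
  simp only at this
  zify at hM
  omega

theorem IsFuss.sweep_eq {k n M : ℕ} {w : Path} (h : IsFuss k n w) (hM : k * n < M) :
    sweep (k * n + 1) n w = sweepRows k M 0 w := by
  unfold sweep
  rw [zip_startRanks]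
  set g : ℕ × ℕ × Step → ℤ × Step := fun v => (vertexRank (k * n + 1) n v, v.2.2) with hg
  set S := (List.range M).flatMap fun j : ℕ =>
      (vertices 0 0 w).filter fun v => level k v = (j : ℤ) with hS
  have hperm : (S.map g).Perm ((vertices 0 0 w).map g) := (h.perm_vertices hM).map g
  have hpw : (S.map g).Pairwise fun a b => a.1 < b.1 := by
    rw [List.pairwise_map]; exact h.pairwise_rank
  have heq : (((vertices 0 0 w).map g).mergeSort fun a b => decide (a.1 ≤ b.1)) = S.map g := by
    refine List.Perm.eq_of_pairwise (le := fun a b => a.1 ≤ b.1) ?_ ?_ ?_ ?_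
    · intro a b ha hb hab hba
      rw [List.mem_mergeSort] at ha
      -- Only first components are compared, so antisymmetry holds on this list rather than in
      -- general: the ranks in it are distinct.
      have key : ∀ a ∈ S.map g, ∀ b ∈ S.map g, a.1 = b.1 → a = b := by
        have hsymm : Std.Symm fun a b : ℤ × Step => a.1 = b.1 → a = b :=
          ⟨fun _ _ hab e => (hab e.symm).symm⟩
        refine List.Pairwise.forall_of_forall ?_ ?_
        · exact fun _ _ _ => rfl
        · exact hpw.imp fun hlt e => absurd e hlt.ne
      exact key a (hperm.mem_iff.2 ha) b hb (le_antisymm hab hba)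
    · have := List.pairwise_mergeSort (le := fun a b : ℤ × Step => decide (a.1 ≤ b.1))
        (fun a b c hab hbc => by simp at *; omega) (fun a b => by simp; omega)
        ((vertices 0 0 w).map g)
      exact this.imp fun hab => by simpa using hab
    · exact hpw.imp le_of_lt
    · exact (List.mergeSort_perm _ _).trans hperm.symm
  rw [heq, hS]
  simp only [sweepRows, row, levels_zero, List.map_flatMap, List.filter_map, List.map_map]
  rfl

theorem crossCount_cons_right {α : Type*} (R : α → α → Bool) (l : List α) (b : α) (l' : List α) :
    crossCount R l (b :: l') = l.countP (fun a => R a b) + crossCount R l l' := by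
  induction l with
  | nil => simp [crossCount]
  | cons a l ih =>
    simp only [crossCount, List.map_cons, List.sum_cons, List.countP_cons] at ih ⊢
    rw [ih]; ring

@[simp] theorem crossCount_nil_right {α : Type*} (R : α → α → Bool) (l : List α) :
    crossCount R l [] = 0 := by
  simp [crossCount]

theorem crossCount_eq_zero {α : Type*} {R : α → α → Bool} {l l' : List α}
    (h : ∀ a ∈ l, ∀ b ∈ l', R a b = false) : crossCount R l l' = 0 := by
  induction l' with
  | nil => simp
  | cons b l' ih =>
    rw [crossCount_cons_right, ih fun a ha c hc => h a ha c (List.mem_cons_of_mem _ hc),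
      add_zero, List.countP_eq_zero]
    exact fun a ha => by simp [h a ha b]

theorem pairCount_eq_zero {α : Type*} {R : α → α → Bool} {l : List α}
    (h : ∀ a ∈ l, ∀ b ∈ l, R a b = false) : pairCount R l = 0 := by
  induction l with
  | nil => rfl
  | cons b l ih =>
    rw [pairCount, ih fun a ha c hc => h a (List.mem_cons_of_mem _ ha) c (List.mem_cons_of_mem _ hc),
      add_zero, List.countP_eq_zero]
    exact fun a ha => by simp [h b _ a (List.mem_cons_of_mem _ ha)]

/-! ### Rows -/

theorem row_append (k : ℕ) (j a : ℤ) (u w : Path) :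
    row k j a (u ++ w) = row k j a u ++ row k j (a + height k u) w := by
  simp [row, levels_append]

theorem row_cons (k : ℕ) (j a : ℤ) (s : Step) (w : Path) :
    row k j a (s :: w) = (if a = j then [s] else []) ++ row k j (a + rise k s) w := by
  simp only [row, levels_cons, List.filter_cons, decide_eq_true_eq]
  split_ifs <;> rfl

theorem length_row (k : ℕ) (j a : ℤ) (w : Path) :
    (row k j a w).length = (levels k a w).countP fun v => v.1 = j := by
  simp [row, List.countP_eq_length_filter]

theorem row_eq_nil {k : ℕ} {j a : ℤ} {w : Path} (h : ∀ v ∈ levels k a w, v.1 ≠ j) :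
    row k j a w = [] := by
  simp only [row, List.map_eq_nil_iff, List.filter_eq_nil_iff, decide_eq_true_eq]
  exact h

theorem eq_east_of_mem_row {k : ℕ} {j a : ℤ} {w : Path}
    (h : ∀ v ∈ levels k a w, v.2 = Step.north → v.1 ≠ j) : ∀ s ∈ row k j a w, s = Step.east := by
  intro s hs
  simp only [row, List.mem_map, List.mem_filter, decide_eq_true_eq] at hs
  obtain ⟨v, ⟨hv, hj⟩, rfl⟩ := hs
  cases hN : v.2
  · exact absurd hj (h v hv hN)
  · rfl

theorem sweepRows_succ (k M : ℕ) (a : ℤ) (w : Path) :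
    sweepRows k (M + 1) a w = sweepRows k M a w ++ row k M a w := by
  simp [sweepRows, List.range_succ]

theorem sweepRows_add (k M r : ℕ) (a : ℤ) (w : Path) :
    sweepRows k (M + r) a w =
      sweepRows k M a w ++ (List.range r).flatMap fun j : ℕ => row k ((M + j : ℕ) : ℤ) a w := by
  simp [sweepRows, List.range_add, List.flatMap_append, List.flatMap_map]

theorem length_sweepRows {k : ℕ} {a : ℤ} {w : Path} (h : Nonneg k a w) (M : ℕ) :
    (sweepRows k M a w).length = (levels k a w).countP fun v => v.1 < (M : ℤ) := by
  induction M with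
  | zero =>
    rw [eq_comm]
    simp only [sweepRows, List.range_zero, List.flatMap_nil, List.length_nil, List.countP_eq_zero]
    intro v hv
    have := h v hv
    simpa using this
  | succ M ih =>
    rw [sweepRows_succ, List.length_append, ih, length_row]
    generalize levels k a w = l
    induction l with
    | nil => rfl
    | cons v l ihl =>
      simp only [List.countP_cons, ← ihl]
      by_cases h1 : v.1 < (M : ℤ)
      · have h2 : v.1 ≠ M := by omega
        simp [h1, h2, h1.le]; omega
      · by_cases h2 : v.1 = M
        · simp [h2]; omega
        · have h3 : ¬ v.1 < ((M + 1 : ℕ) : ℤ) := by push_cast; omega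
          simp [h1, h2]; omega

theorem sweep_perm (m n : ℕ) (w : Path) : (sweep m n w).Perm w := by
  have h := (List.mergeSort_perm ((startRanks m n w).zip w) fun a b => decide (a.1 ≤ b.1)).map
    Prod.snd
  rw [List.map_snd_zip (by simp [startRanks])] at h
  exact h

theorem height_sweep (k m n : ℕ) (w : Path) : height k (sweep m n w) = height k w := by
  rw [height_eq, height_eq, (sweep_perm m n w).count_eq, (sweep_perm m n w).count_eq]

/-! ### Insertion of a North step after which no level is as high -/

theorem mem_levels_replicate_east {k i : ℕ} {a : ℤ} {v : ℤ × Step}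
    (hv : v ∈ levels k (a + i) (List.replicate i Step.east)) : a < v.1 ∧ v.2 = Step.east := by
  induction i with
  | zero => simp at hv
  | succ i ih =>
    rw [List.replicate_succ, levels_cons, List.mem_cons] at hv
    rcases hv with rfl | hv
    · simp only [lt_add_iff_pos_right, and_true]; positivity
    · refine ih ?_
      convert hv using 2
      simp only [rise_east]; push_cast; ring

/-- The path `A ++ B` has all its North steps at levels at most the level at the end of `A`, and at
smaller levels in `B`, and `B` begins with an East step. -/
structure IsPeak (k : ℕ) (A B : Path) : Prop where
  left : ∀ v ∈ levels k 0 A, v.2 = Step.north → v.1 ≤ height k A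
  right : ∀ v ∈ levels k (height k A) B, v.2 = Step.north → v.1 < height k A
  east : ∃ B', B = Step.east :: B'

/-- Inserts a North step and `k` East steps. -/
def insertPeak (k : ℕ) (A B : Path) : Path :=
  A ++ Step.north :: (List.replicate k Step.east ++ B)

theorem exists_last_highest_north (k : ℕ) (c : ℤ) {w : Path} (h : 0 < w.count Step.north) :
    ∃ A C, w = A ++ Step.north :: C ∧
      (∀ v ∈ levels k c A, v.2 = Step.north → v.1 ≤ c + height k A) ∧
      ∀ v ∈ levels k (c + height k A + k) C, v.2 = Step.north → v.1 < c + height k A := by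
  induction w generalizing c with
  | nil => simp at h
  | cons s w ih =>
    cases s
    · by_cases h0 : w.count Step.north = 0
      · refine ⟨[], w, rfl, by simp, ?_⟩
        intro v hv hN
        have h1 := countP_levels_north k (c + height k [] + k) w
        rw [h0, List.countP_eq_zero] at h1
        exact absurd hN (by simpa using h1 v hv)
      · obtain ⟨A, C, rfl, hA, hC⟩ := ih (c + k) (Nat.pos_of_ne_zero h0)
        -- On a tie the later North step wins.
        by_cases hc : c ≤ c + k + height k A
        · refine ⟨Step.north :: A, C, rfl, ?_, ?_⟩
          · intro v hv hN
            rw [levels_cons, List.mem_cons] at hv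
            rcases hv with rfl | hv
            · simpa [add_assoc] using hc
            · simpa [add_assoc] using hA v hv hN
          · simpa [add_assoc] using hC
        · refine ⟨[], A ++ Step.north :: C, rfl, by simp, ?_⟩
          intro v hv hN
          simp only [height_nil, add_zero, levels_append, List.mem_append, levels_cons,
            List.mem_cons, rise_north] at hv ⊢
          rcases hv with hv | rfl | hv
          · have := hA v hv hN
            omega
          · simp only; omega
          · have := hC v hv hN
            omega
    · obtain ⟨A, C, rfl, hA, hC⟩ := ih (c - 1) (by simpa using h)
      refine ⟨Step.east :: A, C, rfl, ?_, ?_⟩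
      · intro v hv hN
        rw [levels_cons, List.mem_cons] at hv
        rcases hv with rfl | hv
        · simp at hN
        · have := hA v hv hN
          simp only [height_cons, rise_east]; omega
      · rw [height_cons, rise_east]
        rw [show c + (-1 + height k A) = c - 1 + height k A by ring]
        exact hC

/-- A path at level $a+i$ that must end below $a$, with no North step at level $\ge a$, has to
descend straight to below $a$, which takes $i+1$ East steps. -/
theorem exists_replicate_east_append {k : ℕ} {a : ℤ} (i : ℕ) {C : Path}
    (hC : ∀ v ∈ levels k (a + i) C, v.2 = Step.north → v.1 < a)
    (hend : a + i + height k C < a) : ∃ C', C = List.replicate i Step.east ++ Step.east :: C' := by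
  induction i generalizing C with
  | zero =>
    cases C with
    | nil => simp at hend
    | cons s C =>
      cases s
      · have := hC (a + (0 : ℕ), Step.north) (by simp) rfl
        simp at this
      · exact ⟨C, rfl⟩
  | succ i ih =>
    cases C with
    | nil => simp at hend; omega
    | cons s C =>
      cases s
      · have := hC (a + (i + 1 : ℕ), Step.north) (by simp) rfl
        simp only at this; omega
      · obtain ⟨C', rfl⟩ := ih (C := C) (fun v hv => hC v (by
          rw [levels_cons, List.mem_cons]
          right
          convert hv using 2
          simp only [rise_east]; push_cast; ring)) (by
            simp only [height_cons, rise_east] at hend; push_cast at hend; linarith)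
        exact ⟨C', rfl⟩

theorem IsFuss.exists_insertPeak {k n : ℕ} {w : Path} (h : IsFuss k (n + 1) w) :
    ∃ A B, w = insertPeak k A B ∧ IsPeak k A B ∧ IsFuss k n (A ++ B) := by
  obtain ⟨A, C, rfl, hA, hC⟩ := exists_last_highest_north k 0 (w := w) (by rw [h.1]; omega)
  rw [zero_add] at hA hC
  have hnn := h.2.2
  have hh := h.2.1
  simp only [nonneg_append, nonneg_cons, zero_add, height_append, height_cons, rise_north]
    at hnn hh
  obtain ⟨C', rfl⟩ := exists_replicate_east_append k hC (by omega)
  have hlev : height k A + k + height k (List.replicate k Step.east) = height k A := by simp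
  rw [nonneg_append, hlev] at hnn
  rw [levels_append, hlev] at hC
  refine ⟨A, Step.east :: C', rfl, ⟨hA, fun v hv => hC v (List.mem_append_right _ hv), C', rfl⟩,
    ?_, ?_, ?_⟩
  · have := h.1
    simp [List.count_append, List.count_replicate] at this ⊢
    omega
  · simp at hh ⊢
    omega
  · rw [nonneg_append, zero_add]
    exact ⟨hnn.1, hnn.2.2.2⟩

/-- Let $a$ be the level at the end of $A$. The inserted East steps start at levels $a+1,\dots,a+k$,
so rows below $a$ do not change. Row $a$ reads $A$, then the new North step, then $B$, which has
only East steps there; above $a$ everything is East. So $X$ consists of the rows below $a$ and the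
part of row $a$ from $A$. -/
theorem IsPeak.exists_sweep_eq {k n : ℕ} {A B : Path} (hp : IsPeak k A B)
    (h : IsFuss k n (A ++ B)) (h' : IsFuss k (n + 1) (insertPeak k A B)) :
    ∃ X s, sweep (k * n + 1) n (A ++ B) = X ++ List.replicate (s + 1) Step.east ∧
      sweep (k * (n + 1) + 1) (n + 1) (insertPeak k A B) =
        X ++ Step.north :: List.replicate (s + 1 + k) Step.east ∧
      X.length = (levels k 0 (A ++ B)).countP (fun v => v.1 < height k A) +
        (levels k 0 A).countP (fun v => v.1 = height k A) := by
  have hnn := h'.2.2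
  simp only [insertPeak, nonneg_append, nonneg_cons, zero_add] at hnn
  obtain ⟨a, ha⟩ := Int.eq_ofNat_of_zero_le hnn.2.1
  obtain ⟨B', rfl⟩ := hp.east
  have hleft := hp.left
  have hright := hp.right
  rw [ha] at hleft hright
  have hrow : ∀ j : ℤ, row k j 0 (A ++ Step.east :: B') =
      row k j 0 A ++ row k j a (Step.east :: B') := by
    intro j; rw [row_append, zero_add, ha]
  have hrow' : ∀ j : ℤ, row k j 0 (insertPeak k A (Step.east :: B')) =
      row k j 0 A ++ ((if (a : ℤ) = j then [Step.north] else []) ++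
        (row k j ((a : ℤ) + k) (List.replicate k Step.east) ++ row k j a (Step.east :: B'))) := by
    intro j
    rw [insertPeak, row_append, zero_add, ha, row_cons, row_append, rise_north]
    simp
  have hrep : ∀ j : ℤ, j ≤ a → row k j ((a : ℤ) + k) (List.replicate k Step.east) = [] :=
    fun j hj => row_eq_nil fun v hv => by
      have := (mem_levels_replicate_east hv).1
      omega
  -- Slack that makes the range of levels $0,\dots,a+r$ long enough for both paths.
  set r := k * (n + 1) with hr
  have hlow : sweepRows k a 0 (insertPeak k A (Step.east :: B')) =
      sweepRows k a 0 (A ++ Step.east :: B') := by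
    simp only [sweepRows]
    refine List.flatMap_congr fun j hj => ?_
    rw [List.mem_range] at hj
    rw [hrow, hrow', hrep j (by omega), if_neg (by omega)]
    simp
  set X := sweepRows k a 0 (A ++ Step.east :: B') ++ row k a 0 A with hX
  have hupE : ∀ (w : Path), (∀ j : ℕ, ∀ s ∈ row k ((a + 1 + j : ℕ) : ℤ) 0 w, s = Step.east) →
      ∃ i, ((List.range r).flatMap fun j : ℕ => row k ((a + 1 + j : ℕ) : ℤ) 0 w) =
        List.replicate i Step.east := by
    intro w hw
    refine ⟨_, List.eq_replicate_iff.2 ⟨rfl, fun s hs => ?_⟩⟩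
    obtain ⟨j, -, hj⟩ := List.mem_flatMap.1 hs
    exact hw j s hj
  have hA_E : ∀ j : ℤ, (a : ℤ) < j → ∀ s ∈ row k j 0 A, s = Step.east := fun j hj =>
    eq_east_of_mem_row fun v hv hN => by have := hleft v hv hN; omega
  have hB_E : ∀ j : ℤ, (a : ℤ) ≤ j → ∀ s ∈ row k j a (Step.east :: B'), s = Step.east :=
    fun j hj => eq_east_of_mem_row fun v hv hN => by have := hright v hv hN; omega
  have hR_E : ∀ j : ℤ, ∀ s ∈ row k j ((a : ℤ) + k) (List.replicate k Step.east), s = Step.east :=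
    fun j => eq_east_of_mem_row fun v hv hN => by
      rw [(mem_levels_replicate_east hv).2] at hN; simp at hN
  obtain ⟨i₁, hi₁⟩ := hupE (A ++ Step.east :: B') fun j s hs => by
    rw [hrow, List.mem_append] at hs
    exact hs.elim (hA_E _ (by push_cast; omega) s) (hB_E _ (by push_cast; omega) s)
  obtain ⟨i₂, hi₂⟩ := hupE (insertPeak k A (Step.east :: B')) fun j s hs => by
    rw [hrow', if_neg (by push_cast; omega), List.nil_append, List.mem_append,
      List.mem_append] at hs
    rcases hs with hs | hs | hs
    · exact hA_E _ (by push_cast; omega) s hs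
    · exact hR_E _ s hs
    · exact hB_E _ (by push_cast; omega) s hs
  obtain ⟨i₃, hi₃⟩ : ∃ i, row k a a (Step.east :: B') = List.replicate (i + 1) Step.east := by
    refine ⟨(row k a ((a : ℤ) + rise k Step.east) B').length,
      List.eq_replicate_iff.2 ⟨?_, hB_E a le_rfl⟩⟩
    rw [row_cons, if_pos rfl]
    simp
  have e₁ : sweep (k * n + 1) n (A ++ Step.east :: B') =
      X ++ List.replicate (i₃ + i₁ + 1) Step.east := by
    rw [h.sweep_eq (M := a + 1 + r) (by rw [hr, mul_add]; omega), sweepRows_add, hi₁,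
      sweepRows_succ, hrow, hi₃, hX, List.append_assoc, List.append_assoc, List.append_assoc,
      List.replicate_append_replicate, add_right_comm]
  have e₂ : sweep (k * (n + 1) + 1) (n + 1) (insertPeak k A (Step.east :: B')) =
      X ++ Step.north :: List.replicate (i₃ + 1 + i₂) Step.east := by
    rw [h'.sweep_eq (M := a + 1 + r) (by omega), sweepRows_add, hi₂,
      sweepRows_succ, hlow, hrow', hrep a le_rfl, if_pos rfl, hi₃, hX]
    simp
  refine ⟨X, i₃ + i₁, e₁, ?_, ?_⟩
  · rw [e₂]
    have l₁ := congrArg List.length e₁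
    have l₂ := congrArg List.length e₂
    rw [(sweep_perm _ _ _).length_eq] at l₁ l₂
    simp [insertPeak] at l₁ l₂
    congr 3
    omega
  · rw [hX, List.length_append, length_sweepRows h.2.2, length_row, ha]

/-! ### Change of dinv under insertion of a peak -/

theorem countP_dinvRel_replicate (k i : ℕ) (a b : ℤ) (hb : b < a) :
    ((levels k (a + i) (List.replicate i Step.east)).countP
      (fun u => dinvRel k u (b, Step.north)) : ℤ) = min (i : ℤ) (max (b + k + 1 - a) 0) := by
  induction i with
  | zero => simp
  | succ i ih =>
    have e : a + ((i + 1 : ℕ) : ℤ) + rise k Step.east = a + i := by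
      simp only [rise_east]; push_cast; ring
    rw [List.replicate_succ, levels_cons, List.countP_cons, e]
    push_cast
    rw [ih]
    by_cases hc : a + i + 1 - b ≤ k + 1
    · rw [if_pos (by simp [dinvRel]; omega)]
      omega
    · rw [if_neg (by simp [dinvRel]; omega)]
      omega

/-- Follow the potential $\max(\text{level}+1-a,0)$ along $B$. A North step from $b<a$ raises it by
$\max(b+k+1-a,0)$, which is the number of inserted East steps it pairs with; an East step lowers it
by one exactly when it starts at level $\ge a$. -/
theorem crossCount_replicate {k : ℕ} {a c : ℤ} {B : Path}
    (hB : ∀ v ∈ levels k c B, v.2 = Step.north → v.1 < a) :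
    (crossCount (dinvRel k) (levels k (a + k) (List.replicate k Step.east)) (levels k c B) : ℤ) =
      (levels k c B).countP (fun v => a ≤ v.1) - max (c + 1 - a) 0 +
        max (c + height k B + 1 - a) 0 := by
  induction B generalizing c with
  | nil => simp
  | cons s B ih =>
    rw [levels_cons] at hB
    have hB' := ih fun v hv => hB v (List.mem_cons_of_mem _ hv)
    rw [levels_cons, crossCount_cons_right, List.countP_cons]
    push_cast
    rw [hB']
    cases s
    · have hc : c < a := hB (c, Step.north) (by simp) rfl
      rw [countP_dinvRel_replicate k k a c hc]
      simp only [height_cons, rise_north, decide_eq_true_eq, if_neg hc.not_ge]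
      rw [← add_assoc]
      omega
    · have h0 : (levels k (a + k) (List.replicate k Step.east)).countP
          (fun u => dinvRel k u (c, Step.east)) = 0 := by
        rw [List.countP_eq_zero]; simp [dinvRel]
      rw [h0]
      simp only [height_cons, rise_east, decide_eq_true_eq]
      rw [← add_assoc]
      split_ifs <;> omega

theorem level_le_of_north_le {k : ℕ} {a c : ℤ} {A : Path} (hc : c ≤ a + k)
    (hA : ∀ v ∈ levels k c A, v.2 = Step.north → v.1 ≤ a) : ∀ v ∈ levels k c A, v.1 ≤ a + k := by
  induction A generalizing c with
  | nil => simp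
  | cons s A ih =>
    rw [levels_cons] at hA ⊢
    intro v hv
    rcases List.mem_cons.1 hv with rfl | hv
    · exact hc
    · refine ih ?_ (fun u hu => hA u (List.mem_cons_of_mem _ hu)) v hv
      cases s
      · have := hA (c, Step.north) (by simp) rfl
        simp only [rise_north]; simp only at this; omega
      · simp only [rise_east]; omega

/-- The new North step pairs with all vertices of $A$ above level $a$: these start East steps and
are at most at $a+k$. The new East steps make as many pairs with $B$ as $B$ has vertices at level
$\ge a$, minus one, since $B$ goes from $a$ to $-1$. -/
theorem IsPeak.pairCount_insertPeak {k n : ℕ} {A B : Path} (hp : IsPeak k A B)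
    (h : IsFuss k n (A ++ B)) :
    pairCount (dinvRel k) (levels k 0 (insertPeak k A B)) + 1 +
      (levels k 0 (A ++ B)).countP (fun v => v.1 < height k A) +
        (levels k 0 A).countP (fun v => v.1 = height k A) =
      pairCount (dinvRel k) (levels k 0 (A ++ B)) + (A ++ B).length := by
  set a := height k A with ha
  have ha0 : 0 ≤ a := by
    obtain ⟨B', rfl⟩ := hp.east
    have := h.2.2
    simp only [nonneg_append, nonneg_cons, zero_add] at this
    exact this.2.1
  have hlev : levels k 0 (insertPeak k A B) = levels k 0 A ++ ([(a, Step.north)] ++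
      (levels k (a + k) (List.replicate k Step.east) ++ levels k a B)) := by
    rw [insertPeak, levels_append, levels_cons, levels_append]
    simp [ha]
  have hlev' : levels k 0 (A ++ B) = levels k 0 A ++ levels k a B := by
    rw [levels_append, zero_add]
  set R := levels k (a + k) (List.replicate k Step.east) with hR
  have c1 : pairCount (dinvRel k) R = 0 := pairCount_eq_zero fun u _ v hv => by
    simp [dinvRel, (mem_levels_replicate_east hv).2]
  have c2 : crossCount (dinvRel k) (levels k 0 A) R = 0 := crossCount_eq_zero fun u _ v hv => by
    simp [dinvRel, (mem_levels_replicate_east hv).2]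
  have c3 : ∀ l, crossCount (dinvRel k) [(a, Step.north)] l = 0 := fun l =>
    crossCount_eq_zero fun u hu v _ => by
      rw [List.mem_singleton] at hu; simp [dinvRel, hu]
  have c4 : pairCount (dinvRel k) [(a, Step.north)] = 0 := pairCount_eq_zero fun u hu v _ => by
      rw [List.mem_singleton] at hu; simp [dinvRel, hu]
  have c5 : crossCount (dinvRel k) (levels k 0 A) [(a, Step.north)] =
      (levels k 0 A).countP fun v => a < v.1 := by
    rw [crossCount_cons_right, crossCount_nil_right, add_zero]
    refine List.countP_congr fun v hv => ?_
    have h1 := level_le_of_north_le (by omega) hp.left v hv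
    have h2 := hp.left v hv
    rw [← ha] at h1 h2
    cases hs : v.2
    · have := h2 hs
      simp [dinvRel, hs, this]
    · simp [dinvRel, hs]; omega
  have c6 := crossCount_replicate hp.right
  rw [← ha, ← hR] at c6
  have hh := h.2.1
  rw [height_append] at hh
  rw [← ha] at hh
  rw [max_eq_left (by omega), max_eq_right (by omega)] at c6
  have t1 : ∀ l : List (ℤ × Step), l.countP (fun v => v.1 < a) + l.countP (fun v => v.1 = a) +
      l.countP (fun v => a < v.1) = l.length := by
    intro l
    induction l with
    | nil => rfl
    | cons v l ih =>
      simp only [List.countP_cons, List.length_cons, ← ih]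
      rcases lt_trichotomy v.1 a with hl | hl | hl
      · simp [hl, hl.ne, hl.not_gt]; omega
      · simp [hl]; omega
      · simp [hl, hl.ne', hl.not_gt]; omega
  have t2 : ∀ l : List (ℤ × Step), l.countP (fun v => v.1 < a) + l.countP (fun v => a ≤ v.1) =
      l.length := by
    intro l
    induction l with
    | nil => rfl
    | cons v l ih =>
      simp only [List.countP_cons, List.length_cons, ← ih]
      rcases lt_or_ge v.1 a with hl | hl
      · simp [hl, hl.not_ge]; omega
      · simp [hl, hl.not_gt]; omega
  have t1' := t1 (levels k 0 A)
  have t2' := t2 (levels k a B)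
  rw [length_levels] at t1' t2'
  rw [hlev, hlev']
  simp only [pairCount_append, crossCount_append_right, c1, c2, c3, c4, c5,
    List.countP_append, List.length_append]
  omega

/-! ### The sweep map is a bijection that sends `dinv` to `area` -/

theorem IsFuss.eq_of_zero {k : ℕ} {w : Path} (h : IsFuss k 0 w) : w = [Step.east] := by
  have h1 : w = List.replicate w.length Step.east := by
    refine List.eq_replicate_iff.2 ⟨rfl, fun s hs => ?_⟩
    cases s
    · exact absurd hs (List.count_eq_zero.1 h.1)
    · rfl
  rw [h.length_eq] at h1
  simpa using h1

/-- The count is the position of the cut in the order by level, then from left to right. The cut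
vertex itself, where $B$ starts, is at level $a$ and not counted, so a higher cut, or a later one at
the same level, has a strictly larger count. -/
theorem IsPeak.eq_of_countP_eq {k : ℕ} {A₁ B₁ A₂ B₂ : Path} (h₁ : IsPeak k A₁ B₁)
    (h₂ : IsPeak k A₂ B₂) (he : A₁ ++ B₁ = A₂ ++ B₂)
    (hc : (levels k 0 (A₁ ++ B₁)).countP (fun v => v.1 < height k A₁) +
        (levels k 0 A₁).countP (fun v => v.1 = height k A₁) =
      (levels k 0 (A₁ ++ B₁)).countP (fun v => v.1 < height k A₂) +
        (levels k 0 A₂).countP (fun v => v.1 = height k A₂)) : A₁ = A₂ ∧ B₁ = B₂ := by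
  have hlt : ∀ A B : Path, IsPeak k A B → ∀ b, height k A < b →
      (levels k 0 (A ++ B)).countP (fun v => v.1 < height k A) +
        (levels k 0 A).countP (fun v => v.1 = height k A) <
      (levels k 0 (A ++ B)).countP (fun v => v.1 < b) := by
    intro A B hp b hb
    obtain ⟨B', rfl⟩ := hp.east
    have key : ∀ l : List (ℤ × Step), l.countP (fun v => v.1 < height k A) +
        l.countP (fun v => v.1 = height k A) ≤ l.countP (fun v => v.1 < b) := by
      intro l
      induction l with
      | nil => simp
      | cons v l ih =>
        simp only [List.countP_cons]
        rcases lt_trichotomy v.1 (height k A) with hl | hl | hl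
        · simp [hl, hl.ne, hl.trans hb]; omega
        · simp [hl, hb]; omega
        · simp [hl.ne', hl.not_gt]; omega
    have := key (levels k 0 (A ++ Step.east :: B'))
    rw [levels_append, List.countP_append (p := fun v : ℤ × Step => decide (v.1 = height k A)), zero_add,
      levels_cons, List.countP_cons (p := fun v : ℤ × Step => decide (v.1 = height k A))] at this
    rw [levels_append, zero_add, levels_cons]
    simp only [decide_true, if_true] at this
    omega
  have hheight : height k A₁ = height k A₂ := by
    rcases lt_trichotomy (height k A₁) (height k A₂) with hl | hl | hl
    · have := hlt A₁ B₁ h₁ _ hl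
      omega
    · exact hl
    · have := hlt A₂ B₂ h₂ _ hl
      rw [← he] at this
      omega
  rw [hheight, Nat.add_left_cancel_iff] at hc
  have hpre : ∀ A B C : Path, IsPeak k A (C ++ B) → height k A = height k (A ++ C) →
      (levels k 0 A).countP (fun v => v.1 = height k A) =
      (levels k 0 (A ++ C)).countP (fun v => v.1 = height k A) → C = [] := by
    intro A B C hp hh hcc
    cases C with
    | nil => rfl
    | cons s C =>
      rw [levels_append, List.countP_append, levels_cons, List.countP_cons, zero_add] at hcc
      simp only [decide_true, if_true] at hcc
      omega
  rcases List.append_eq_append_iff.1 he with ⟨C, hC1, hC2⟩ | ⟨C, hC1, hC2⟩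
  · have := hpre A₁ B₂ C (hC2 ▸ h₁) (hC1 ▸ hheight) (by rw [← hC1, hheight]; exact hc)
    subst this
    simpa [eq_comm] using And.intro hC1 hC2
  · have := hpre A₂ B₁ C (hC2 ▸ h₂) (hC1 ▸ hheight.symm) (by rw [← hC1]; exact hc.symm)
    subst this
    simpa [eq_comm] using And.intro hC1 hC2

theorem append_north_replicate_inj {X Y : Path} {i j : ℕ}
    (h : X ++ Step.north :: List.replicate i Step.east =
      Y ++ Step.north :: List.replicate j Step.east) : X = Y ∧ i = j := by
  have key : ∀ (i : ℕ) (C : Path), List.replicate i Step.east ≠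
      C ++ Step.north :: List.replicate j Step.east := by
    intro i C hC
    have : Step.north ∈ List.replicate i Step.east := by rw [hC]; simp
    simp at this
  have key' : ∀ (j : ℕ) (C : Path), List.replicate j Step.east ≠
      C ++ Step.north :: List.replicate i Step.east := by
    intro i C hC
    have : Step.north ∈ List.replicate i Step.east := by rw [hC]; simp
    simp at this
  rcases List.append_eq_append_iff.1 h with ⟨C, hC1, hC2⟩ | ⟨C, hC1, hC2⟩
  · cases C with
    | nil => simp at hC1 hC2; exact ⟨hC1.symm, hC2⟩
    | cons s C =>
      rw [List.cons_append, List.cons_eq_cons] at hC2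
      exact absurd hC2.2 (key _ _)
  · cases C with
    | nil => simp at hC1 hC2; exact ⟨hC1, hC2.symm⟩
    | cons s C =>
      rw [List.cons_append, List.cons_eq_cons] at hC2
      exact absurd hC2.2 (key' _ _)

theorem IsFuss.sweep_isFuss_and_northSum {k n : ℕ} {w : Path} (h : IsFuss k n w) :
    IsFuss k n (sweep (k * n + 1) n w) ∧
      northSum k 0 (sweep (k * n + 1) n w) = pairCount (dinvRel k) (levels k 0 w) := by
  induction n generalizing w with
  | zero =>
    obtain rfl := h.eq_of_zero
    rw [List.perm_singleton.1 (sweep_perm _ _ [Step.east])]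
    exact ⟨h, rfl⟩
  | succ n ih =>
    obtain ⟨A, B, rfl, hp, h'⟩ := h.exists_insertPeak
    obtain ⟨X, s, e₁, e₂, hX⟩ := hp.exists_sweep_eq h' h
    obtain ⟨hF, hS⟩ := ih h'
    rw [e₁] at hF hS
    have hh := hF.2.1
    have hnn := hF.2.2
    rw [height_append, height_replicate_east] at hh
    push_cast at hh
    rw [nonneg_append, zero_add] at hnn
    rw [northSum_append, northSum_replicate_east, add_zero] at hS
    refine ⟨⟨?_, ?_, ?_⟩, ?_⟩
    · rw [(sweep_perm _ _ _).count_eq, h.1]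
    · rw [height_sweep, h.2.1]
    · rw [e₂, nonneg_append, nonneg_cons, zero_add]
      refine ⟨hnn.1, by omega, nonneg_replicate_east _ _ ?_⟩
      rw [rise_north]; push_cast; omega
    -- The word $X$ ends at level $s$, because $X\,E^{s+1}$ ends at $-1$. So area grows by $s$, and
    -- dinv by $|AB|-|X|-1=s$.
    · have hd := hp.pairCount_insertPeak h'
      have hl := congrArg List.length e₁
      rw [(sweep_perm _ _ _).length_eq, List.length_append (as := X), List.length_replicate] at hl
      rw [e₂, northSum_append, hS, northSum, northSum_replicate_east]
      zify at hd hl hX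
      omega

theorem IsFuss.sweep_inj {k n : ℕ} {w₁ w₂ : Path} (h₁ : IsFuss k n w₁) (h₂ : IsFuss k n w₂)
    (he : sweep (k * n + 1) n w₁ = sweep (k * n + 1) n w₂) : w₁ = w₂ := by
  induction n generalizing w₁ w₂ with
  | zero => rw [h₁.eq_of_zero, h₂.eq_of_zero]
  | succ n ih =>
    obtain ⟨A₁, B₁, rfl, hp₁, h₁'⟩ := h₁.exists_insertPeak
    obtain ⟨A₂, B₂, rfl, hp₂, h₂'⟩ := h₂.exists_insertPeak
    obtain ⟨X, s, e₁, e₂, hX⟩ := hp₁.exists_sweep_eq h₁' h₁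
    obtain ⟨Y, r, f₁, f₂, hY⟩ := hp₂.exists_sweep_eq h₂' h₂
    rw [e₂, f₂] at he
    obtain ⟨rfl, hs⟩ := append_north_replicate_inj he
    -- The word after the sweep determines $X$ and $s$, hence the sweep of the shorter path; then
    -- $|X|$ locates the peak.
    obtain rfl : s = r := by omega
    have hAB := ih h₁' h₂' (e₁.trans f₁.symm)
    obtain ⟨rfl, rfl⟩ := hp₁.eq_of_countP_eq hp₂ hAB (by rw [← hX, hY, hAB])
    rfl

theorem IsFuss.area_sweep {k n : ℕ} {w : Path} (h : IsFuss k n w) :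
    area (k * n + 1) n (sweep (k * n + 1) n w) = dinv (k * n + 1) n w := by
  have := h.sweep_isFuss_and_northSum
  rw [← this.1.area_eq, ← h.dinv_eq] at this
  exact_mod_cast this.2

theorem bijOn_sweep (k n : ℕ) : Set.BijOn (sweep (k * n + 1) n)
    (dyckPaths (k * n + 1) n : Set Path) (dyckPaths (k * n + 1) n : Set Path) := by
  have hm : Set.MapsTo (sweep (k * n + 1) n)
      (dyckPaths (k * n + 1) n : Set Path) (dyckPaths (k * n + 1) n : Set Path) := fun w hw => by
    rw [Finset.mem_coe, mem_dyckPaths_iff] at hw ⊢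
    exact hw.sweep_isFuss_and_northSum.1
  have hi : Set.InjOn (sweep (k * n + 1) n) (dyckPaths (k * n + 1) n : Set Path) :=
    fun w hw u hu he => by
      rw [Finset.mem_coe, mem_dyckPaths_iff] at hw hu
      exact hw.sweep_inj hu he
  exact ⟨hm, hi, Finset.surjOn_of_injOn_of_card_le _ hm hi le_rfl⟩

/-! ### Rotation of paths -/

theorem Nonneg.head {k : ℕ} {a : ℤ} {w : Path} (h : Nonneg k a w) (hw : w ≠ []) : 0 ≤ a := by
  cases w with
  | nil => exact absurd rfl hw
  | cons s w => exact ((nonneg_cons _ _ _ _).1 h).1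

/-- The cut is at the leftmost vertex of minimal level: $A$ never goes below its start, and $B$
stays strictly above that vertex. A step added in front moves the cut to the new start as soon as
that is at most as high. -/
theorem exists_rotation (k : ℕ) (W : Path) :
    ∃ A B, W = B ++ A ∧ Nonneg k 0 A ∧ Nonneg k (-height k B - 1) B ∧
      0 ≤ height k A := by
  induction W with
  | nil => exact ⟨[], [], by simp⟩
  | cons s W ih =>
    obtain ⟨A, B, rfl, hA, hB, h0⟩ := ih
    by_cases hs : rise k s + height k B < 0
    · refine ⟨A, s :: B, rfl, hA, ?_, h0⟩
      rw [nonneg_cons, height_cons]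
      refine ⟨by omega, ?_⟩
      convert hB using 1
      ring
    · refine ⟨s :: (B ++ A), [], rfl, ?_, by simp, by
        rw [height_cons, height_append]; omega⟩
      rw [nonneg_cons, nonneg_append, zero_add]
      exact ⟨le_rfl, hB.mono (by omega), hA.mono (by omega)⟩

/-- If two cuts differ by a nonempty $C$, one path shows that $C$ has height $\ge 0$ and the other
that the remaining word does; together they have height $-1$. -/
theorem IsFuss.rotation_unique {k n : ℕ} {A B A' B' : Path} (h : IsFuss k n (A ++ B))
    (h' : IsFuss k n (A' ++ B')) (hB : B ≠ []) (hB' : B' ≠ []) (he : B ++ A = B' ++ A') :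
    A = A' ∧ B = B' := by
  have key : ∀ A B C : Path, IsFuss k n ((C ++ A) ++ B) → IsFuss k n (A ++ (B ++ C)) → B ≠ [] →
      C = [] := by
    intro A B C h₁ h₂ hB
    by_contra hC
    have n₁ := h₁.2.2
    have n₂ := h₂.2.2
    have e₂ := h₂.2.1
    rw [List.append_assoc, nonneg_append, zero_add] at n₁
    rw [← List.append_assoc, nonneg_append, zero_add] at n₂
    have := n₁.2.head (by simp [hB])
    have := n₂.2.head hC
    simp only [height_append] at *
    omega
  rcases List.append_eq_append_iff.1 he with ⟨C, rfl, rfl⟩ | ⟨C, rfl, rfl⟩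
  · obtain rfl := key _ _ C h h' hB
    simp
  · obtain rfl := key _ _ C h' h hB'
    simp

/-- The path obtained by exchanging two parts of a path and adding a North step in front and `k`
East steps at the end. -/
def glue (k : ℕ) (A B : Path) : Path :=
  Step.north :: (B ++ A ++ List.replicate k Step.east)

theorem IsFuss.height_left {k n : ℕ} {A B : Path} (h : IsFuss k n (A ++ B)) :
    height k B = -1 - height k A := by
  have := h.2.1
  rw [height_append] at this
  omega

theorem IsFuss.isFuss_glue {k n : ℕ} {A B : Path} (h : IsFuss k n (A ++ B))
    (hA : height k A < k) : IsFuss k (n + 1) (glue k A B) := by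
  have hB := h.height_left
  have hnn := h.2.2
  rw [nonneg_append, zero_add] at hnn
  refine ⟨?_, ?_, ?_⟩
  · have := h.1
    simp [glue, List.count_append, List.count_replicate] at this ⊢
    omega
  · simp only [glue, height_cons, height_append, hB, height_replicate_east, rise_north]
    ring
  · simp only [glue, nonneg_cons, nonneg_append, rise_north, height_append, zero_add, le_refl,
      true_and]
    exact ⟨⟨hnn.2.mono hA.le, hnn.1.mono (by omega)⟩, nonneg_replicate_east _ _ (by omega)⟩

/-- The last North step, if any, leads to level at least $k$, and only East steps lead from there to
$-1$. -/
theorem eq_replicate_or_exists_append {k : ℕ} {a : ℤ} {w : Path} (h : Nonneg k a w)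
    (he : a + height k w = -1) :
    w = List.replicate (a + 1).toNat Step.east ∨ ∃ W, w = W ++ List.replicate k Step.east := by
  induction w generalizing a with
  | nil =>
    left
    rw [height_nil] at he
    rw [show (a + 1).toNat = 0 by omega]
    rfl
  | cons s w ih =>
    rw [nonneg_cons] at h
    rw [height_cons, ← add_assoc] at he
    rcases ih h.2 he with hw | ⟨W, hW⟩
    · cases s
      · right
        refine ⟨Step.north :: List.replicate (a + 1).toNat Step.east, ?_⟩
        rw [List.cons_append, List.replicate_append_replicate, hw]
        congr 2
        simp only [rise_north]; omega
      · left
        rw [hw, ← List.replicate_succ]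
        congr 1
        simp only [rise_east]; omega
    · exact Or.inr ⟨s :: W, by rw [hW]; rfl⟩

theorem IsFuss.exists_glue {k n : ℕ} (hk : 1 ≤ k) {w : Path} (h : IsFuss k (n + 1) w) :
    ∃ A B, w = glue k A B ∧ IsFuss k n (A ++ B) ∧ B ≠ [] ∧ height k A < k := by
  obtain ⟨s, w, rfl⟩ : ∃ s u, w = s :: u := by
    cases w with
    | nil => have := h.1; simp at this
    | cons s u => exact ⟨s, u, rfl⟩
  have hnn := h.2.2
  have hh := h.2.1
  rw [nonneg_cons, zero_add] at hnn
  rw [height_cons] at hh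
  cases s
  · obtain ⟨W, rfl⟩ : ∃ W, w = W ++ List.replicate k Step.east := by
      rcases eq_replicate_or_exists_append hnn.2 hh with hw | hw
      · refine ⟨[Step.east], ?_⟩
        rw [hw, rise_north, show ((k : ℤ) + 1).toNat = k + 1 by omega]
        rfl
      · exact hw
    obtain ⟨A, B, rfl, hA, hB, h0⟩ := exists_rotation k W
    simp only [height_append, height_replicate_east, rise_north] at hh
    have hB' : B ≠ [] := by
      rintro rfl
      rw [height_nil] at hh
      omega
    refine ⟨A, B, rfl, ⟨?_, ?_, ?_⟩, hB', ?_⟩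
    · have := h.1
      simp [List.count_append, List.count_replicate] at this ⊢
      omega
    · rw [height_append]; omega
    · rw [nonneg_append, zero_add]
      exact ⟨hA, hB.mono (by omega)⟩
    -- In the given path $A$ starts at level $k-1-\text{height}(A)$, which is $\ge 0$ if $A$ has a
    -- step; for empty $A$ the bound is $k\ge 1$.
    · rcases eq_or_ne A [] with rfl | hA'
      · rw [height_nil]; omega
      · have := hnn.2
        simp only [nonneg_append, rise_north] at this
        have := this.1.2.head hA'
        omega
  · exfalso
    cases w with
    | nil => have := h.1; simp at this
    | cons s w =>
      have := hnn.2.head (by simp)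
      simp at this

/-- The North steps of $B$ are lifted by $k-\text{height}(A)$ and those of $A$ by one less. -/
theorem IsFuss.northSum_glue {k n : ℕ} {A B : Path} (h : IsFuss k n (A ++ B)) :
    northSum k 0 (glue k A B) =
      northSum k 0 (A ++ B) + (k - height k A) * n - A.count Step.north := by
  have hB := h.height_left
  have hn : (n : ℤ) = A.count Step.north + B.count Step.north := by
    rw [← h.1, List.count_append]; push_cast; rfl
  simp only [glue, northSum, northSum_append, northSum_replicate_east, zero_add]
  have e1 := northSum_add k (height k A) (k - height k A) B
  have e2 := northSum_add k 0 (k + height k B) A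
  rw [add_sub_cancel] at e1
  rw [zero_add] at e2
  rw [e1, e2, hB, hn]
  ring

/-! ### The sweep of a glued path -/

theorem row_replicate_east (k i : ℕ) (j a : ℤ) :
    row k j (a + i) (List.replicate i Step.east) =
      if a < j ∧ j ≤ a + i then [Step.east] else [] := by
  induction i with
  | zero => rw [if_neg (by push_cast; omega)]; rfl
  | succ i ih =>
    have e : a + ((i + 1 : ℕ) : ℤ) + rise k Step.east = a + i := by
      simp only [rise_east]; push_cast; ring
    rw [List.replicate_succ, row_cons, e, ih]
    by_cases h1 : a + ((i + 1 : ℕ) : ℤ) = j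
    · rw [if_pos h1, if_neg (by omega), if_pos (by omega)]; rfl
    · rw [if_neg h1, List.nil_append]
      congr 1
      push_cast at h1 ⊢
      exact propext (by omega)

theorem row_add (k : ℕ) (j a c : ℤ) (w : Path) : row k (j + c) (a + c) w = row k j a w := by
  simp only [row, levels_add, List.filter_map, List.map_map]
  simp only [Function.comp_def, add_left_inj]

/-- Before row $j$ exactly $j$ extra East steps have been read, so its North steps are shifted by
$a-b-j$. -/
theorem northSum_flatMap_append_east (k i : ℕ) (a b : ℤ) (R : ℕ → Path) :
    northSum k a ((List.range i).flatMap fun j => R j ++ [Step.east]) =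
      northSum k b ((List.range i).flatMap R) +
        ∑ j ∈ Finset.range i, (a - b - j) * (R j).count Step.north ∧
    height k ((List.range i).flatMap fun j => R j ++ [Step.east]) =
      height k ((List.range i).flatMap R) - i := by
  induction i with
  | zero => simp [northSum]
  | succ i ih =>
    simp only [List.range_succ, List.flatMap_append, List.flatMap_singleton, northSum_append,
      height_append, ih.1, ih.2, Finset.sum_range_succ]
    have e := northSum_add k (b + height k ((List.range i).flatMap R)) (a - b - i) (R i)
    rw [show b + height k ((List.range i).flatMap R) + (a - b - i) =
      a + (height k ((List.range i).flatMap R) - i) by ring] at e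
    rw [e]
    simp [northSum]
    constructor <;> ring

/-- Follow the potential $\min(\text{level},k-1)$: a North step from $c<k$ raises it by $k-1-c$, an
East step from $c<k$ lowers it by one, and steps from levels $\ge k$ leave it unchanged. -/
theorem sum_mul_count_row {k : ℕ} {c : ℤ} {W : Path} (h : Nonneg k c W) :
    ∑ j ∈ Finset.range k, ((k : ℤ) - j) * (row k j c W).count Step.north =
      (levels k c W).countP (fun v => v.1 < (k : ℤ)) - min c (k - 1) +
        min (c + height k W) (k - 1) := by
  induction W generalizing c with
  | nil => simp [row]
  | cons s W ih =>
    rw [nonneg_cons] at h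
    have hs : ∑ j ∈ Finset.range k, ((k : ℤ) - j) *
        ((if c = (j : ℤ) then [s] else []).count Step.north : ℕ) =
        if s = Step.north then max (k - c) 0 else 0 := by
      obtain ⟨c, rfl⟩ := Int.eq_ofNat_of_zero_le h.1
      cases s
      · rw [if_pos rfl]
        by_cases hc : c < k
        · rw [Finset.sum_eq_single_of_mem c (Finset.mem_range.2 hc)]
          · simp; omega
          · intro j _ hj
            rw [if_neg (by omega)]
            simp
        · rw [Finset.sum_eq_zero, max_eq_right (by omega)]
          intro j hj
          rw [Finset.mem_range] at hj
          rw [if_neg (by omega)]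
          simp
      · rw [if_neg (by simp), Finset.sum_eq_zero]
        intro j _
        split_ifs <;> simp
    simp only [row_cons, List.count_append, Nat.cast_add, mul_add, Finset.sum_add_distrib, ih h.2,
      hs, levels_cons, List.countP_cons, height_cons, decide_eq_true_eq]
    rw [← add_assoc c]
    have := h.1
    cases s
    · simp only [rise_north, if_true]
      split_ifs <;> push_cast <;> omega
    · simp only [rise_east, reduceCtorEq, if_false]
      split_ifs <;> push_cast <;> omega

/-- Regrouping: the pairs $b_i\,a_{i+1}$ in succession, beginning with $a_0$, spell
$a_0b_0a_1b_1\cdots$. The block $a_0$ occurs at $j=c-1$, hence $c\ge 1$, and the surplus last block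
$a_M$ is empty. -/
theorem flatMap_shift {c M : ℕ} (hc : 1 ≤ c) {a b : ℤ → Path} (ha : ∀ j < 0, a j = [])
    (hb : ∀ j < 0, b j = []) (haM : a M = []) :
    ((List.range (c + M)).flatMap fun j : ℕ => b ((j : ℤ) - c) ++ a ((j : ℤ) - c + 1)) =
      (List.range M).flatMap fun j : ℕ => a j ++ b j := by
  have h1 : ((List.range c).flatMap fun j : ℕ => b ((j : ℤ) - c) ++ a ((j : ℤ) - c + 1)) = a 0 := by
    obtain ⟨c, rfl⟩ := Nat.exists_eq_add_of_le' hc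
    rw [List.range_succ, List.flatMap_append, List.flatMap_singleton,
      List.flatMap_eq_nil_iff.2, hb _ (by push_cast; omega)]
    · simp
    · intro j hj
      rw [List.mem_range] at hj
      rw [hb _ (by push_cast; omega), ha _ (by push_cast; omega)]
      rfl
  have h2 : ∀ M : ℕ, a 0 ++ ((List.range M).flatMap fun j : ℕ => b j ++ a ((j : ℤ) + 1)) =
      ((List.range M).flatMap fun j : ℕ => a j ++ b j) ++ a M := by
    intro M
    induction M with
    | zero => simp
    | succ M ih =>
      rw [List.range_succ, List.flatMap_append, List.flatMap_append, ← List.append_assoc, ih]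
      simp
  rw [List.range_add, List.flatMap_append, h1, List.flatMap_map]
  have h3 := h2 M
  rw [haM, List.append_nil] at h3
  rw [← h3]
  simp

/-- With $a=\text{height}(A)$ and $c=k-a$, the middle $BA$ of the glued path lifts $B$ by $c$ and
$A$ by $c-1$. Its rows in order therefore spell the sweep of $AB$. The first North step and the East
steps at levels $k-1,\dots,0$ lift the North steps of row $j<k$ by $k-j$, and the weighted sum of
these lifts is the number of vertices of $BA$ below level $k$. -/
theorem IsFuss.northSum_sweep_glue {k n : ℕ} {A B : Path} (h : IsFuss k n (A ++ B))
    (hA : height k A < k) (hB : B ≠ []) :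
    northSum k 0 (sweep (k * (n + 1) + 1) (n + 1) (glue k A B)) =
      northSum k 0 (sweep (k * n + 1) n (A ++ B)) +
        (levels k 0 A).countP (fun v => v.1 ≤ height k A) +
        (levels k (height k A) B).countP (fun v => v.1 < height k A) := by
  have hnn := h.2.2
  rw [nonneg_append, zero_add] at hnn
  obtain ⟨a, ha⟩ := Int.eq_ofNat_of_zero_le (hnn.2.head hB)
  have hhB := h.height_left
  rw [ha] at hA hhB hnn ⊢
  obtain ⟨c, rfl⟩ : ∃ c, k = a + c := Nat.exists_eq_add_of_le (by omega)
  set k := a + c with hk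
  have hc : 1 ≤ c := by omega
  clear_value k
  set M := a + (k * n + 1) with hM
  set R : ℕ → Path := fun j => row k j k (B ++ A) with hR
  have hR' : ∀ j : ℕ, R j = row k ((j : ℤ) - c) a B ++ row k ((j : ℤ) - c + 1) 0 A := by
    intro j
    have e1 := row_add k ((j : ℤ) - c) a c B
    have e2 := row_add k ((j : ℤ) - c + 1) 0 (c - 1) A
    rw [show (j : ℤ) - c + c = j by ring, show (a : ℤ) + c = k by rw [hk]; push_cast; ring] at e1
    rw [show (j : ℤ) - c + 1 + (c - 1) = j by ring,
      show (0 : ℤ) + (c - 1) = k + height k B by rw [hhB, hk]; push_cast; ring] at e2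
    rw [← e1, ← e2, ← row_append]
  have hsw : sweep (k * n + 1) n (A ++ B) = (List.range (c + M)).flatMap R := by
    rw [h.sweep_eq (M := M) (by omega), List.flatMap_congr fun j _ => hR' j,
      flatMap_shift (a := fun j => row k j 0 A) (b := fun j => row k j a B) hc]
    · simp only [sweepRows, row_append, zero_add, ha]
    · exact fun j hj => row_eq_nil fun v hv => by have := hnn.1 v hv; omega
    · exact fun j hj => row_eq_nil fun v hv => by have := hnn.2 v hv; omega
    · refine row_eq_nil fun v hv => ?_
      have := h.level_le (v := v) (by rw [levels_append]; exact List.mem_append_left _ hv)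
      rw [hM]; push_cast; omega
  have hg := h.isFuss_glue (ha.trans_lt hA)
  have hrow : ∀ j : ℕ, row k j 0 (glue k A B) = (if (0 : ℤ) = j then [Step.north] else []) ++
      (R j ++ if j < k then [Step.east] else []) := by
    intro j
    have e := row_replicate_east k k j (-1)
    rw [glue, row_cons, row_append, rise_north, zero_add, height_append, hhB, ha,
      show (k : ℤ) + (-1 - a + a) = -1 + k by ring, e]
    congr 2
    congr 1
    exact propext (by omega)
  have hsw' : sweep (k * (n + 1) + 1) (n + 1) (glue k A B) =
      Step.north :: (((List.range k).flatMap fun j => R j ++ [Step.east]) ++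
        (List.range (k * n + 1)).flatMap fun j => R (k + j)) := by
    rw [hg.sweep_eq (M := k + (k * n + 1)) (by rw [mul_add]; omega), sweepRows_add]
    have e1 : ((List.range (k * n + 1)).flatMap fun j : ℕ =>
        row k ((k + j : ℕ) : ℤ) 0 (glue k A B)) =
        (List.range (k * n + 1)).flatMap fun j => R (k + j) := by
      refine List.flatMap_congr fun j _ => ?_
      rw [hrow, if_neg (by push_cast; omega), if_neg (by omega)]
      simp
    have e2 : ∀ i : ℕ, i + 1 ≤ k → sweepRows k (i + 1) 0 (glue k A B) =
        Step.north :: (List.range (i + 1)).flatMap fun j => R j ++ [Step.east] := by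
      intro i
      induction i with
      | zero =>
        intro hi
        rw [sweepRows_succ, hrow, if_pos (by simp), if_pos (by omega)]
        simp [sweepRows]
      | succ i ih =>
        intro hi
        rw [sweepRows_succ, ih (by omega), hrow, if_neg (by push_cast; omega),
          if_pos (by omega), List.range_succ (n := i + 1)]
        simp
    obtain ⟨i, hi⟩ : ∃ i, k = i + 1 := ⟨k - 1, by omega⟩
    have e3 := e2 i (by omega)
    rw [← hi] at e3
    rw [e1, e3]
    rfl
  have hcM : c + M = k + (k * n + 1) := by omega
  have hcount := sum_mul_count_row (k := k) (c := k) (W := B ++ A) (by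
    rw [nonneg_append, hhB]
    exact ⟨hnn.2.mono hA.le, hnn.1.mono (by omega)⟩)
  -- The lead of $k$ from the first North step is used up after $k$ rows, so the higher rows
  -- contribute the same to both sums.
  obtain ⟨g1, g2⟩ := northSum_flatMap_append_east k k k 0 R
  rw [hcM, List.range_add, List.flatMap_append, List.flatMap_map] at hsw
  rw [hsw, hsw', northSum, northSum_append, northSum_append, zero_add, zero_add, zero_add, g1, g2,
    add_sub_cancel]
  have hcount' : ((levels k k (B ++ A)).countP (fun v => v.1 < (k : ℤ)) : ℤ) =
      (levels k 0 A).countP (fun v => v.1 ≤ (a : ℤ)) +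
        (levels k a B).countP (fun v => v.1 < (a : ℤ)) := by
    have e1 := levels_add k a c B
    have e2 := levels_add k 0 (c - 1) A
    rw [show (a : ℤ) + c = k by rw [hk]; push_cast; ring] at e1
    rw [show (0 : ℤ) + (c - 1) = k + height k B by rw [hhB, hk]; push_cast; ring] at e2
    rw [levels_append, e1, e2, List.countP_append, List.countP_map, List.countP_map, add_comm]
    push_cast
    congr 2
    · refine List.countP_congr fun v _ => ?_
      simp [hk]; omega
    · refine List.countP_congr fun v _ => ?_
      simp [hk]
  have hz : (k : ℤ) + height k (B ++ A) = k - 1 := by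
    rw [height_append, hhB, ha]; ring
  rw [hz, min_eq_right (by omega), min_self, hcount'] at hcount
  simp only [hR, sub_zero] at *
  rw [hcount]
  ring

/-! ### Sums over the rank sequence -/

theorem countP_lt_getElem {s : List ℤ} (hs : s.Pairwise (· < ·)) (i : ℕ) (hi : i < s.length) :
    s.countP (fun b => b < s[i]) = i := by
  induction s generalizing i with
  | nil => simp at hi
  | cons a s ih =>
    rw [List.pairwise_cons] at hs
    cases i with
    | zero =>
      rw [List.countP_eq_zero]
      intro b hb
      rcases List.mem_cons.1 hb with rfl | hb
      · simp
      · simpa using (hs.1 b hb).le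
    | succ i =>
      have hi' : i < s.length := by simpa using hi
      rw [List.countP_cons]
      simp only [List.getElem_cons_succ]
      rw [ih hs.2 i hi', if_pos (by simpa using hs.1 _ (List.getElem_mem hi'))]

/-- Passes from positions in the rank sequence to positions on the path. Ranks are distinct, so
$i-1$ is the number of ranks smaller than the $i$-th. -/
theorem sum_rankAt {β : Type*} [AddCommMonoid β] {m n : ℕ} {w : Path}
    (h : (startRanks m n w).Nodup) (F : ℕ → ℤ → β) :
    ∑ i ∈ Finset.Icc 1 w.length, F (i - 1) (rankAt m n w i) =
      ∑ p ∈ Finset.range w.length,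
        F ((startRanks m n w).countP fun b => b < rank m n (w.take p)) (rank m n (w.take p)) := by
  have hperm : (rankSeq m n w).Perm (startRanks m n w) := List.mergeSort_perm _ _
  have hlen : (rankSeq m n w).length = w.length := by
    rw [hperm.length_eq]; simp [startRanks]
  have hsorted : (rankSeq m n w).Pairwise (· < ·) := by
    have h1 := List.pairwise_mergeSort (le := fun a b : ℤ => decide (a ≤ b))
      (fun a b c hab hbc => by simp at *; omega) (fun a b => by simp; omega) (startRanks m n w)
    have h2 : (rankSeq m n w).Nodup := hperm.nodup_iff.2 h
    exact (h1.and h2).imp fun hab => lt_of_le_of_ne (by simpa using hab.1) hab.2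
  have e1 : ∑ i ∈ Finset.Icc 1 w.length, F (i - 1) (rankAt m n w i) =
      ∑ i ∈ Finset.range w.length, F i ((rankSeq m n w).getD i 0) := by
    rw [← Finset.Ico_add_one_right_eq_Icc, Finset.sum_Ico_eq_sum_range]
    refine Finset.sum_congr (by simp) fun i _ => ?_
    simp [rankAt]
  have e2 : ∑ i ∈ Finset.range w.length, F i ((rankSeq m n w).getD i 0) =
      ((rankSeq m n w).map fun a => F ((startRanks m n w).countP fun b => b < a) a).sum := by
    change ((List.range w.length).map fun i => F i ((rankSeq m n w).getD i 0)).sum = _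
    congr 1
    refine List.ext_getElem (by simp [hlen]) fun i h1 h2 => ?_
    have hi : i < (rankSeq m n w).length := by simpa using h2
    rw [List.getElem_map, List.getElem_map, List.getElem_range, ← hperm.countP_eq,
      countP_lt_getElem hsorted i hi, List.getD_eq_getElem _ _ hi]
  rw [e1, e2, (hperm.map _).sum_eq, startRanks, List.map_map]
  rfl

theorem IsFuss.nodup_startRanks {k n : ℕ} {w : Path} (h : IsFuss k n w) :
    (startRanks (k * n + 1) n w).Nodup := by
  have hp := (h.perm_vertices (M := k * n + 1) (by omega)).map (vertexRank (k * n + 1) n)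
  rw [startRanks_eq, ← hp.nodup_iff]
  refine List.Pairwise.imp (R := (· < ·)) (fun hab => hab.ne) ?_
  rw [List.pairwise_map]
  exact h.pairwise_rank

theorem rank_eq (k n : ℕ) (u : Path) :
    rank (k * n + 1) n u = n * height k u + u.count Step.north := by
  rw [rank, height_eq]; push_cast; ring

theorem IsFuss.countP_startRanks {k n : ℕ} {A B : Path} (h : IsFuss k n (A ++ B)) (hB : B ≠ []) :
    (startRanks (k * n + 1) n (A ++ B)).countP (fun b => b < rank (k * n + 1) n A) =
      (levels k 0 A).countP (fun v => v.1 ≤ height k A) +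
        (levels k (height k A) B).countP (fun v => v.1 < height k A) := by
  obtain ⟨s, B, rfl⟩ := List.exists_cons_of_ne_nil hB
  have hpw := h.rank_lt_iff
  rw [vertices_append, List.pairwise_append] at hpw
  obtain ⟨V, hV⟩ : ∃ V, vertices (0 + A.count Step.east) (0 + A.count Step.north) (s :: B) =
      (A.count Step.east, A.count Step.north, s) :: V := by
    cases s <;> simp [vertices]
  obtain ⟨-, hpB, hpA⟩ := hpw
  have hlB := map_level_vertices k (0 + A.count Step.east) (0 + A.count Step.north) (s :: B)
  rw [zero_add, zero_add, ← height_eq] at hlB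
  rw [zero_add, zero_add] at hV hpB hpA
  set v : ℕ × ℕ × Step := (A.count Step.east, A.count Step.north, s) with hv
  have hlev : level k v = height k A := by rw [height_eq]; rfl
  have hrank : vertexRank (k * n + 1) n v = rank (k * n + 1) n A := rfl
  rw [startRanks_eq, vertices_append, zero_add, zero_add, List.map_append, List.countP_append,
    List.countP_map, List.countP_map, ← hlB, levels_zero, List.countP_map, List.countP_map, hV,
    ← hrank, ← hlev]
  rw [hV] at hpA hpB
  rw [List.pairwise_cons] at hpB
  congr 1
  · refine List.countP_congr fun u hu => ?_
    have := (hpA u hu v List.mem_cons_self).1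
    simpa using this
  · refine List.countP_congr fun u hu => ?_
    rcases List.mem_cons.1 hu with rfl | hu
    · simp
    · have := (hpB.1 u hu).2
      simpa using this

/-- The rank is $n\cdot\text{height}+y$ with $y\le n$. Height below $k$ gives at most $nk$; height
at least $k\ge 1$ needs $y\ge 1$ and gives at least $nk+1$. -/
theorem IsFuss.rank_lt_iff_height_lt {k n : ℕ} (hk : 1 ≤ k) {A B : Path}
    (h : IsFuss k n (A ++ B)) :
    rank (k * n + 1) n A < ((k * n + 1 : ℕ) : ℤ) ↔ height k A < k := by
  have hn : (A.count Step.north : ℤ) ≤ n := by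
    rw [← h.1, List.count_append]; push_cast; omega
  rw [rank_eq]
  push_cast
  constructor
  · intro hlt
    by_contra! hc
    have : (1 : ℤ) ≤ A.count Step.north := by
      by_contra! h0
      have : (A.count Step.north : ℤ) = 0 := by omega
      rw [height_eq, this] at hc
      omega
    nlinarith
  · intro hlt
    nlinarith

/-! ### The recursion -/

theorem sum_sweepInv {β : Type*} [AddCommMonoid β] (k n : ℕ) (F : Path → Path → β) :
    ∑ D ∈ dyckPaths (k * n + 1) n, F D (sweepInv (k * n + 1) n D) =
      ∑ D ∈ dyckPaths (k * n + 1) n, F (sweep (k * n + 1) n D) D := by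
  have hb := bijOn_sweep k n
  symm
  refine Finset.sum_nbij (sweep (k * n + 1) n) (fun D hD => hb.mapsTo hD) hb.injOn hb.surjOn ?_
  intro D hD
  rw [sweepInv, hb.injOn.leftInvOn_invFunOn hD]

theorem higherCatalan_eq (k n : ℕ) : higherCatalan k n =
    ∑ D ∈ dyckPaths (k * n + 1) n,
      q ^ dinv (k * n + 1) n D * t ^ area (k * n + 1) n D := by
  rw [higherCatalan]
  refine (sum_sweepInv k n fun D E => q ^ area (k * n + 1) n D * t ^ area (k * n + 1) n E).trans ?_
  refine Finset.sum_congr rfl fun D hD => ?_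
  rw [(mem_dyckPaths_iff.1 hD).area_sweep]

theorem IsFuss.dinv_glue {k n : ℕ} {A B : Path} (h : IsFuss k n (A ++ B))
    (hA : height k A < k) (hB : B ≠ []) :
    dinv (k * (n + 1) + 1) (n + 1) (glue k A B) = dinv (k * n + 1) n (A ++ B) +
      (startRanks (k * n + 1) n (A ++ B)).countP (fun b => b < rank (k * n + 1) n A) := by
  have hg := h.isFuss_glue hA
  have := h.northSum_sweep_glue hA hB
  rw [hg.sweep_isFuss_and_northSum.2, h.sweep_isFuss_and_northSum.2, ← hg.dinv_eq, ← h.dinv_eq]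
    at this
  rw [h.countP_startRanks hB]
  zify
  linarith

theorem IsFuss.area_glue {k n : ℕ} {A B : Path} (h : IsFuss k n (A ++ B))
    (hA : height k A < k) :
    area (k * (n + 1) + 1) (n + 1) (glue k A B) = area (k * n + 1) n (A ++ B) +
      ((n : ℤ) * k - rank (k * n + 1) n A).toNat := by
  have hg := h.isFuss_glue hA
  have e := h.northSum_glue
  rw [← hg.area_eq, ← h.area_eq] at e
  have hn : (A.count Step.north : ℤ) ≤ n := by
    rw [← h.1, List.count_append]; push_cast; omega
  -- The exponent of $t$ is not truncated: level at most $k-1$ and $y\le n$ give rank at most $nk$.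
  have h0 : 0 ≤ (n : ℤ) * k - rank (k * n + 1) n A := by
    rw [rank_eq]; nlinarith
  zify
  rw [Int.toNat_of_nonneg h0, e, rank_eq]
  ring

theorem higherCatalan_succ {k : ℕ} (hk : 1 ≤ k) (n : ℕ) : higherCatalan k (n + 1) =
    ∑ D ∈ dyckPaths (k * n + 1) n,
      q ^ dinv (k * n + 1) n D * t ^ area (k * n + 1) n D *
        ∑ i ∈ Finset.Icc 1 (k * n + 1 + n),
          if rankAt (k * n + 1) n D i < ((k * n + 1 : ℕ) : ℤ) then
            q ^ (i - 1) * t ^ ((n : ℤ) * k - rankAt (k * n + 1) n D i).toNat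
          else 0 := by
  have hinner : ∀ D ∈ dyckPaths (k * n + 1) n,
      q ^ dinv (k * n + 1) n D * t ^ area (k * n + 1) n D *
        (∑ i ∈ Finset.Icc 1 (k * n + 1 + n),
          if rankAt (k * n + 1) n D i < ((k * n + 1 : ℕ) : ℤ) then
            q ^ (i - 1) * t ^ ((n : ℤ) * k - rankAt (k * n + 1) n D i).toNat
          else 0) =
      ∑ p ∈ (Finset.range D.length).filter fun p => height k (D.take p) < k,
        q ^ dinv (k * (n + 1) + 1) (n + 1) (glue k (D.take p) (D.drop p)) *
          t ^ area (k * (n + 1) + 1) (n + 1) (glue k (D.take p) (D.drop p)) := by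
    intro D hD
    rw [mem_dyckPaths_iff] at hD
    rw [← hD.length_eq, sum_rankAt hD.nodup_startRanks fun i r =>
      if r < ((k * n + 1 : ℕ) : ℤ) then q ^ i * t ^ ((n : ℤ) * k - r).toNat else 0,
      Finset.mul_sum, Finset.sum_filter]
    refine Finset.sum_congr rfl fun p hp => ?_
    rw [Finset.mem_range] at hp
    have hs : IsFuss k n (D.take p ++ D.drop p) := by rwa [List.take_append_drop]
    have hne : D.drop p ≠ [] := by
      rw [ne_eq, List.drop_eq_nil_iff]; omega
    simp only [hs.rank_lt_iff_height_lt hk]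
    split_ifs with hlt
    · rw [hs.dinv_glue hlt hne, hs.area_glue hlt, List.take_append_drop, pow_add, pow_add]
      ring
    · rw [mul_zero]
  rw [Finset.sum_congr rfl hinner, higherCatalan_eq, Finset.sum_sigma', eq_comm]
  -- Gluing at the marked vertex is a bijection from paths with a marked starting vertex of level
  -- below $k$ onto the paths of order $n+1$.
  refine Finset.sum_nbij (fun x => glue k (x.1.take x.2) (x.1.drop x.2)) ?_ ?_ ?_ ?_
  · rintro ⟨D, p⟩ hx
    simp only [Finset.mem_sigma, Finset.mem_filter, Finset.mem_range, mem_dyckPaths_iff] at hx ⊢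
    have hs : IsFuss k n (D.take p ++ D.drop p) := by rw [List.take_append_drop]; exact hx.1
    exact hs.isFuss_glue hx.2.2
  · rintro ⟨D, p⟩ hx ⟨E, r⟩ hy he
    simp only [Finset.coe_sigma, Set.mem_sigma_iff, Finset.mem_coe, Finset.mem_filter,
      Finset.mem_range, mem_dyckPaths_iff] at hx hy
    have hs : IsFuss k n (D.take p ++ D.drop p) := by rw [List.take_append_drop]; exact hx.1
    have hs' : IsFuss k n (E.take r ++ E.drop r) := by rw [List.take_append_drop]; exact hy.1
    simp only [glue, List.cons.injEq, true_and, List.append_cancel_right_eq] at he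
    obtain ⟨h1, h2⟩ := hs.rotation_unique hs' (by rw [ne_eq, List.drop_eq_nil_iff]; omega)
      (by rw [ne_eq, List.drop_eq_nil_iff]; omega) he
    have hDE : D = E := by
      rw [← List.take_append_drop p D, h1, h2, List.take_append_drop]
    have hpr := congrArg List.length h1
    rw [List.length_take, List.length_take, min_eq_left hx.2.1.le, min_eq_left hy.2.1.le] at hpr
    rw [hDE, hpr]
  · intro D hD
    rw [Finset.mem_coe, mem_dyckPaths_iff] at hD
    obtain ⟨A, B, rfl, h, hB, hA⟩ := hD.exists_glue hk
    refine ⟨⟨A ++ B, A.length⟩, ?_, by simp⟩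
    simp only [Finset.coe_sigma, Set.mem_sigma_iff, Finset.mem_coe, Finset.mem_filter,
      Finset.mem_range, mem_dyckPaths_iff]
    exact ⟨h, by simpa using List.length_pos_of_ne_nil hB, by simpa using hA⟩
  · intro x _
    rfl

end FussDyck

theorem mainTheorem8 (k n n' m m' : ℕ) (hk : 1 ≤ k) (hn : n = n' + 1)
    (hm : m = k * n + 1) (hm' : m' = k * n' + 1) :
    Set.BijOn (FussDyck.sweep m n)
        (FussDyck.dyckPaths m n : Set FussDyck.Path) (FussDyck.dyckPaths m n : Set FussDyck.Path) ∧
    Set.BijOn (FussDyck.sweep m' n')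
        (FussDyck.dyckPaths m' n' : Set FussDyck.Path)
        (FussDyck.dyckPaths m' n' : Set FussDyck.Path) ∧
    (FussDyck.higherCatalan k n =
      ∑ D' ∈ FussDyck.dyckPaths m' n',
        FussDyck.q ^ FussDyck.area m' n' D' * FussDyck.t ^ FussDyck.bounce m' n' D' *
          ∑ i ∈ Finset.Icc 1 (m' + n'),
            if FussDyck.rankAt m' n' (FussDyck.sweepInv m' n' D') i < (m' : ℤ) then
              FussDyck.q ^ (i - 1) *
                FussDyck.t ^
                  ((n' : ℤ) * (k : ℤ) -
                    FussDyck.rankAt m' n' (FussDyck.sweepInv m' n' D') i).toNat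
            else 0) ∧
    (FussDyck.higherCatalan k n =
      ∑ D' ∈ FussDyck.dyckPaths m' n',
        FussDyck.q ^ FussDyck.dinv m' n' D' * FussDyck.t ^ FussDyck.area m' n' D' *
          ∑ i ∈ Finset.Icc 1 (m' + n'),
            if FussDyck.rankAt m' n' D' i < (m' : ℤ) then
              FussDyck.q ^ (i - 1) *
                FussDyck.t ^
                  ((n' : ℤ) * (k : ℤ) - FussDyck.rankAt m' n' D' i).toNat
            else 0) := by
  subst hn hm hm'
  refine ⟨FussDyck.bijOn_sweep k (n' + 1), FussDyck.bijOn_sweep k n', ?_,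
    FussDyck.higherCatalan_succ hk n'⟩
  rw [FussDyck.higherCatalan_succ hk n']
  refine Eq.trans ?_ (FussDyck.sum_sweepInv k n' fun D E =>
    FussDyck.q ^ FussDyck.area (k * n' + 1) n' D * FussDyck.t ^ FussDyck.area (k * n' + 1) n' E *
      ∑ i ∈ Finset.Icc 1 (k * n' + 1 + n'),
        if FussDyck.rankAt (k * n' + 1) n' E i < ((k * n' + 1 : ℕ) : ℤ) then
          FussDyck.q ^ (i - 1) *
            FussDyck.t ^ ((n' : ℤ) * (k : ℤ) - FussDyck.rankAt (k * n' + 1) n' E i).toNat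
        else 0).symm
  refine Finset.sum_congr rfl fun D hD => ?_
  rw [(FussDyck.mem_dyckPaths_iff.1 hD).area_sweep]
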